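/- Let $d\ge 2$ and let $T_n$ be the rooted regular $d$-ary tree with $n$ levels: its vertices of level $k$ ($0\le k\le n$) are the words of length $k$ in $\{1,\dots,d\}$, the parent of a word being the word with its last letter removed, so that $\mathrm{Aut}(T_n)$ is the $n$-fold iterated wreath product of $S_d$. For $m\le n$ let $\mathrm{sgn}_m:\mathrm{Aut}(T_n)\to\{\pm1\}$ be the sign of the permutation induced on the $d^m$ vertices of level $m$. For a subgroup $H\le \mathrm{Aut}(T_{n-1})$ let $H\wr \mathrm{Aut}(T_1)\le\mathrm{Aut}(T_n)$ be the group of the automorphisms $((a_i)_{1\le i\le d};b)\colon (i,w)\mapsto (b(i),a_i(w))$ with $a_i\in H$ and $b\in S_d$. Define $E_n^m\le\mathrm{Aut}(T_n)$ by $E_1^m=\mathrm{Aut}(T_1)$ and, for $n\ge2$, $$E_n^m=\begin{cases}E_{n-1}^m\wr\mathrm{Aut}(T_1), & n<m,\\ \bigl(E_{n-1}^m\wr\mathrm{Aut}(T_1)\bigr)\cap\ker(\mathrm{sgn}_m), & n\ge m.\end{cases}$$ **Theorem.** Let $K$ be a number field, let $f(z)=2z^3-3z^2+1$, and let $\alpha\in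 K$. For a prime $\mathfrak r$ of $K$ let $v_{\mathfrak r}$ denote the normalized $\mathfrak r$-adic valuation. Suppose that there are primes $\mathfrak p$ and $\mathfrak q$ of $K$ lying above $2$ and $3$ respectively such that $v_{\mathfrak p}(\alpha)=1$ or $v_{\mathfrak p}(1-\alpha)=1$, and $v_{\mathfrak q}(\alpha)=1$ or $v_{\mathfrak q}(1-\alpha)=1$. Let $f^n$ denote the $n$-th iterate of $f$. Then for every $n\ge1$: 1. The polynomial $f^n(z)-\alpha$ is irreducible over $K$; more precisely, for some $c\in\{0,1\}$ the translated polynomial $f^n(z+c)-\alpha$ is Eisenstein at $\mathfrak q$ (over the valuation ring of $\mathfrak q$ in $K$). 2. The Galois group over $K$ of (the splitting field of) $f^n(z)-\alpha$ is isomorphic to $E_n^2$ for the ternary tree ($d=3$). -/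

import Mathlib

open Polynomial NumberField

/-- The automorphism group of the rooted regular `d`-ary tree `T_n` with `n` levels.  A vertex of
level `k ≤ n` is a word `w : Fin k → Fin d` (its first letter is the vertex of level one below
which it lies), and the parent of a word is the word without its last letter.  An automorphism is a
family of permutations of the levels `0, …, n` that commutes with taking parents. -/
def TreeAut (d n : ℕ) : Subgroup (∀ k : Fin (n + 1), Equiv.Perm (Fin k → Fin d)) where
  carrier := {σ | ∀ (k : Fin n) (w : Fin (k + 1) → Fin d),
    (Fin.init (σ k.succ w : Fin (k + 1) → Fin d) : Fin k → Fin d) = σ k.castSucc (Fin.init w)}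
  one_mem' := fun _ _ => rfl
  mul_mem' := by
    intro σ τ hσ hτ k w
    have h1 := hσ k (τ k.succ w)
    have h2 := hτ k w
    simp only [Pi.mul_apply, Equiv.Perm.mul_apply]
    rw [h1, h2]
  inv_mem' := by
    intro σ hσ k w
    have h := hσ k ((σ k.succ).symm w)
    rw [Equiv.apply_symm_apply] at h
    change Fin.init ((σ k.succ).symm w) = (σ k.castSucc).symm (Fin.init w)
    rw [h, Equiv.symm_apply_apply]

/-- `sgn_m : Aut(T_n) → {±1}` for `m ≤ n`: the sign of the permutation that an automorphism
induces on the `d ^ m` vertices of level `m`. -/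
def levelSgn (d n m : ℕ) (hm : m ≤ n) : TreeAut d n →* ℤˣ where
  toFun σ := Equiv.Perm.sign (σ.1 ⟨m, Nat.lt_succ_of_le hm⟩)
  map_one' := by simp
  map_mul' := by intro σ τ; simp

/-- For `H ≤ Aut(T_n)`, the wreath product `H ≀ Aut(T_1)` inside `Aut(T_{n+1})`: all automorphisms
`((a_i)_i ; b)` with `a_i ∈ H` and `b` a permutation of the `d` vertices of level one, acting by
`(i, w) ↦ (b i, a_i w)`. -/
def wreathTop {d n : ℕ} (H : Subgroup (TreeAut d n)) : Subgroup (TreeAut d (n + 1)) where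
  carrier := {σ | ∃ (a : Fin d → TreeAut d n) (b : Equiv.Perm (Fin d)), (∀ i, a i ∈ H) ∧
    ∀ (k : Fin (n + 1)) (i : Fin d) (w : Fin k → Fin d),
      (σ.1 k.succ (Fin.cons i w : Fin (k + 1) → Fin d) : Fin (k + 1) → Fin d) =
        Fin.cons (b i) ((a i).1 k w)}
  one_mem' := ⟨1, 1, fun _ => H.one_mem, fun _ _ _ => rfl⟩
  mul_mem' := by
    rintro σ τ ⟨a, b, ha, hσ⟩ ⟨a', b', ha', hτ⟩
    refine ⟨fun i => a (b' i) * a' i, b * b', fun i => H.mul_mem (ha _) (ha' _), ?_⟩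
    intro k i w
    have h1 := hτ k i w
    have h2 := hσ k (b' i) ((a' i).1 k w)
    change σ.1 k.succ (τ.1 k.succ _) = _
    rw [h1, h2]
    rfl
  inv_mem' := by
    rintro σ ⟨a, b, ha, hσ⟩
    refine ⟨fun i => (a (b⁻¹ i))⁻¹, b⁻¹, fun i => H.inv_mem (ha _), ?_⟩
    intro k i w
    have h := hσ k (b.symm i) (((a (b.symm i)).1 k).symm w)
    rw [Equiv.apply_symm_apply, Equiv.apply_symm_apply] at h
    change (σ.1 k.succ).symm _ = _
    rw [Equiv.symm_apply_eq]
    exact h.symm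

/-- The groups `E_n^m ≤ Aut(T_n)`: `E_1^m = Aut(T_1)`; for `n ≥ 2`, `E_n^m = E_{n-1}^m ≀ Aut(T_1)` if
`n < m`, and `E_n^m = (E_{n-1}^m ≀ Aut(T_1)) ∩ ker(sgn_m)` if `n ≥ m`.  (The value at `n = 0`, where
`Aut(T_0)` is trivial, plays no role.) -/
def EGroup (d m : ℕ) : (n : ℕ) → Subgroup (TreeAut d n)
  | 0 => ⊤
  | 1 => ⊤
  | n + 2 => if hm : m ≤ n + 2 then
      wreathTop (EGroup d m (n + 1)) ⊓ (levelSgn d (n + 2) m hm).ker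
    else wreathTop (EGroup d m (n + 1))

/-- The polynomial `f(z) = 2 z ^ 3 - 3 z ^ 2 + 1`. -/
noncomputable def cubicF (K : Type*) [Field K] : K[X] := 2 * X ^ 3 - 3 * X ^ 2 + 1

/-- The polynomial `f ^ n (z) - α`, with `f ^ n` the `n`-th iterate of `f(z) = 2 z ^ 3 - 3 z ^ 2 + 1`. -/
noncomputable def iterSub {K : Type*} [Field K] (n : ℕ) (α : K) : K[X] :=
  (cubicF K).comp^[n] X - C α

/-- `p ∈ K[X]` is Eisenstein at the prime `v`: its coefficients lie in the valuation ring of `v`, and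
`p` is Eisenstein over that ring with respect to the maximal ideal. -/
def IsEisensteinAtPrime {K : Type*} [Field K] [NumberField K]
    (v : IsDedekindDomain.HeightOneSpectrum (𝓞 K)) (p : K[X]) : Prop :=
  ∃ g : (v.valuation K).valuationSubring[X],
    g.map (algebraMap (v.valuation K).valuationSubring K) = p ∧
      g.IsEisensteinAt (IsLocalRing.maximalIdeal (v.valuation K).valuationSubring)

/-! Irreducibility. The cubic `f` interchanges its critical points 0 and 1, and modulo 3 it is `2z^3
+ 1`, so modulo 3 the polynomial `f^n(z + c)` is a unit times `z^(3^n)` plus the constant `f^n(c)`.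
Choosing `c` in {0, 1} so that `f^n(c) - α` has valuation 1 at `𝔮` gives an Eisenstein polynomial
(`exists_isEisensteinAt_cubicIter`). Hence the Galois group is transitive on every level of the tree
of iterated preimages of `α`.

Upper bound. A fibre `f(c) = v` has squared Vandermonde product `27/4 · v(1 - v)`, and the product
of `c(1 - c)` over the fibre is `v(1 - v)/4`. So the Vandermonde products at a vertex and at its
three children multiply to `±(27/4)^2 v(1 - v)/2`. The fibres can be ordered so that the sign is
always plus (`exists_isLabeling`). Galois elements preserve this identity, which says that `sgn_2`
is trivial on every subtree (`exists_mem_EGroup_induces`).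

Lower bound. Extend the valuation of `𝔭` to the algebraic closure. The value of `α` or `1 - α` is
not a square in the value group of `K`. This property passes to a preimage `c` over the fixed field
of its stabilizer, the new value being a square root of the old one: adjoining `c` is a cubic step,
which cannot supply the missing roots (`IsRamifiedPoint.exists_child`). Consequently the Vandermonde
product `V` of a fibre is not fixed by the group, and `V·V'`, with `V'` belonging to a child, is not
fixed by the stabilizer of that child.

By induction the stabilizer of a level-one vertex induces all of `E_{n-1}` below it. Together with
the two elements moving `V` and `V·V'`, this forces the whole of `E_n` (`EGroup_le_of_generation`).
The group theory is a Goursat argument: `E_{n-1}` is solvable, and its subgroup `A` of elements even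
on level one satisfies `A ≤ [A, E_{n-1}]`. -/

/-! ### Wreath coordinates on tree automorphisms. -/

namespace TreeAut

variable {d n : ℕ}

/-- The permutation that an automorphism induces on the words of length `k`. -/
def lev (σ : TreeAut d n) (k : ℕ) (hk : k ≤ n) : Equiv.Perm (Fin k → Fin d) :=
  σ.1 ⟨k, Nat.lt_succ_of_le hk⟩

theorem ext_lev {σ τ : TreeAut d n} (h : ∀ k hk w, lev σ k hk w = lev τ k hk w) : σ = τ :=
  Subtype.ext (funext fun k => Equiv.ext (h k (Nat.le_of_lt_succ k.2)))

theorem lev_mul (σ τ : TreeAut d n) (k : ℕ) (hk : k ≤ n) :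
    lev (σ * τ) k hk = lev σ k hk * lev τ k hk := rfl

/-- The permutation `(i, w) ↦ (b i, a i w)` of the words of length `k + 1`. -/
def consPerm {k : ℕ} (a : Fin d → Equiv.Perm (Fin k → Fin d)) (b : Equiv.Perm (Fin d)) :
    Equiv.Perm (Fin (k + 1) → Fin d) where
  toFun v := Fin.cons (b (v 0)) (a (v 0) (Fin.tail v))
  invFun v := Fin.cons (b.symm (v 0)) ((a (b.symm (v 0))).symm (Fin.tail v))
  left_inv v := by simp
  right_inv v := by simp

@[simp] theorem consPerm_cons {k : ℕ} (a : Fin d → Equiv.Perm (Fin k → Fin d))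
    (b : Equiv.Perm (Fin d)) (i : Fin d) (w : Fin k → Fin d) :
    consPerm a b (Fin.cons i w : Fin (k + 1) → Fin d) = Fin.cons (b i) (a i w) := by
  simp [consPerm]

theorem init_cons {k : ℕ} (i : Fin d) (w : Fin (k + 1) → Fin d) :
    (Fin.init (Fin.cons i w : Fin (k + 2) → Fin d) : Fin (k + 1) → Fin d) =
      Fin.cons i (Fin.init w) := by
  funext j
  refine Fin.cases rfl (fun j => rfl) j

theorem consPerm_init {k : ℕ} {a : Fin d → Equiv.Perm (Fin (k + 1) → Fin d)}
    {a' : Fin d → Equiv.Perm (Fin k → Fin d)} (b : Equiv.Perm (Fin d))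
    (h : ∀ i w, Fin.init (a i w) = a' i (Fin.init w)) (w : Fin (k + 2) → Fin d) :
    Fin.init (consPerm a b w) = consPerm a' b (Fin.init w) := by
  obtain ⟨i, w, rfl⟩ : ∃ i w', w = (Fin.cons i w' : Fin (k + 2) → Fin d) :=
    ⟨w 0, Fin.tail w, (Fin.cons_self_tail w).symm⟩
  rw [consPerm_cons, init_cons, init_cons, consPerm_cons, h]

/-- The automorphism `(a; b)` of the tree with `n + 1` levels. -/
def mk (a : Fin d → TreeAut d n) (b : Equiv.Perm (Fin d)) : TreeAut d (n + 1) :=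
  ⟨Fin.cases (motive := fun k : Fin (n + 2) => Equiv.Perm (Fin k → Fin d)) 1
    (fun k => consPerm (fun i => (a i).1 k) b), by
    intro k
    refine Fin.cases (fun w => Subsingleton.elim (α := Fin 0 → Fin d) _ _) (fun j => ?_) k
    exact consPerm_init (k := j) b (fun i w => (a i).2 j w)⟩

theorem mk_cons (a : Fin d → TreeAut d n) (b : Equiv.Perm (Fin d)) (k : ℕ) (hk : k ≤ n) (i : Fin d)
    (w : Fin k → Fin d) :
    lev (mk a b) (k + 1) (Nat.succ_le_succ hk) (Fin.cons i w : Fin (k + 1) → Fin d) =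
      Fin.cons (b i) (lev (a i) k hk w) :=
  consPerm_cons (fun i => lev (a i) k hk) b i w

theorem eq_mk {σ : TreeAut d (n + 1)} {a : Fin d → TreeAut d n} {b : Equiv.Perm (Fin d)}
    (h : ∀ (k : ℕ) (hk : k ≤ n) (i : Fin d) (w : Fin k → Fin d),
      lev σ (k + 1) (Nat.succ_le_succ hk) (Fin.cons i w : Fin (k + 1) → Fin d) =
        Fin.cons (b i) (lev (a i) k hk w)) : σ = mk a b := by
  refine ext_lev fun k => ?_
  cases k with
  | zero => exact fun _ _ => Subsingleton.elim _ _
  | succ k =>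
    intro hk w
    obtain ⟨i, w, rfl⟩ : ∃ i w', w = (Fin.cons i w' : Fin (k + 1) → Fin d) :=
      ⟨w 0, Fin.tail w, (Fin.cons_self_tail w).symm⟩
    rw [h k (Nat.le_of_succ_le_succ hk), mk_cons]

theorem mk_mul (a a' : Fin d → TreeAut d n) (b b' : Equiv.Perm (Fin d)) :
    mk a b * mk a' b' = mk (fun i => a (b' i) * a' i) (b * b') := by
  refine eq_mk fun k hk i w => ?_
  rw [lev_mul, Equiv.Perm.mul_apply, mk_cons _ _ k hk, mk_cons _ _ k hk]
  rfl

theorem mk_one : mk (1 : Fin d → TreeAut d n) 1 = 1 :=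
  (eq_mk fun _ _ _ _ => rfl).symm

theorem mk_injective {a a' : Fin d → TreeAut d n} {b b' : Equiv.Perm (Fin d)}
    (h : mk a b = mk a' b') : a = a' ∧ b = b' := by
  have key : ∀ (k : ℕ) (hk : k ≤ n) (i : Fin d) (w : Fin k → Fin d),
      (Fin.cons (b i) (lev (a i) k hk w) : Fin (k + 1) → Fin d) =
        Fin.cons (b' i) (lev (a' i) k hk w) := by
    intro k hk i w
    rw [← mk_cons, ← mk_cons, h]
  constructor
  · funext i
    exact ext_lev fun k hk w => (Fin.cons_injective2 (key k hk i w)).2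
  · ext i
    exact congrArg _ (Fin.cons_injective2 (key 0 (Nat.zero_le n) i Fin.elim0)).1

theorem mk_inv (a : Fin d → TreeAut d n) (b : Equiv.Perm (Fin d)) :
    (mk a b)⁻¹ = mk (fun i => (a (b⁻¹ i))⁻¹) b⁻¹ := by
  rw [inv_eq_iff_mul_eq_one, mk_mul, ← mk_one]
  congr 1
  · funext i
    simp
  · simp

theorem mem_wreathTop {H : Subgroup (TreeAut d n)} {σ : TreeAut d (n + 1)} :
    σ ∈ wreathTop H ↔ ∃ a b, (∀ i, a i ∈ H) ∧ σ = mk a b := by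
  constructor
  · rintro ⟨a, b, ha, h⟩
    exact ⟨a, b, ha, eq_mk fun k hk => h ⟨k, Nat.lt_succ_of_le hk⟩⟩
  · rintro ⟨a, b, ha, rfl⟩
    exact ⟨a, b, ha, fun k => mk_cons a b k (Nat.le_of_lt_succ k.2)⟩

/-- The permutation of the `d` vertices of level one. -/
def top : TreeAut d (n + 1) →* Equiv.Perm (Fin d) where
  toFun σ := (Equiv.funUnique (Fin 1) (Fin d)).permCongr (lev σ 1 (Nat.le_add_left 1 n))
  map_one' := rfl
  map_mul' _ _ := Equiv.permCongr_mul _ _ _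

theorem lev_one_cons (σ : TreeAut d (n + 1)) (i : Fin d) (w : Fin 0 → Fin d) :
    lev σ 1 (Nat.le_add_left 1 n) (Fin.cons i w) = Fin.cons (top σ i) w := by
  have e : (Fin.cons i w : Fin 1 → Fin d) = fun _ => i := by
    funext j
    rw [Subsingleton.elim (α := Fin 1) j 0]
    rfl
  rw [e]
  funext j
  rw [Subsingleton.elim (α := Fin 1) j 0]
  rfl

@[simp] theorem top_mk (a : Fin d → TreeAut d n) (b : Equiv.Perm (Fin d)) : top (mk a b) = b := by
  ext i
  have h := mk_cons a b 0 (Nat.zero_le n) i Fin.elim0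
  rw [lev_one_cons] at h
  exact congrArg _ (Fin.cons_injective2 h).1

theorem eq_mk_top (σ : TreeAut d 1) : σ = mk 1 (top σ) := by
  refine eq_mk fun k hk i w => ?_
  obtain rfl : k = 0 := Nat.le_zero.mp hk
  exact (lev_one_cons σ i w).trans (congrArg _ (Subsingleton.elim _ _))

/-- On pairs of letters the action factors as a permutation inside each block followed by `b` on
first letters. The latter is three copies of `b`, and since 3 is odd it contributes `sign b`. -/
theorem levelSgn_two (a : Fin 3 → TreeAut 3 (n + 1)) (b : Equiv.Perm (Fin 3)) (h : 2 ≤ n + 2) :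
    levelSgn 3 (n + 2) 2 h (mk a b) =
      Equiv.Perm.sign b * ∏ i, Equiv.Perm.sign (top (a i)) := by
  have key : (finTwoArrowEquiv (Fin 3)).permCongr (lev (mk a b) 2 h) =
      Equiv.prodCongrLeft (fun _ => b) * Equiv.prodCongrRight (fun i => top (a i)) := by
    refine Equiv.ext fun ⟨i, j⟩ => ?_
    have h1 := mk_cons a b 1 (Nat.le_add_left 1 n) i (fun _ => j)
    have h2 : (finTwoArrowEquiv (Fin 3)).symm (i, j) = (Fin.cons i (fun _ => j) : Fin 2 → Fin 3) := by
      funext k; fin_cases k <;> rfl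
    change finTwoArrowEquiv (Fin 3) (lev (mk a b) 2 h ((finTwoArrowEquiv (Fin 3)).symm (i, j))) = _
    rw [h2]
    refine Eq.trans (congrArg (finTwoArrowEquiv (Fin 3)) h1) ?_
    rfl
  refine (Equiv.Perm.sign_permCongr (finTwoArrowEquiv (Fin 3)) (lev (mk a b) 2 h)).symm.trans ?_
  rw [key, map_mul, Equiv.Perm.sign_prodCongrLeft, Equiv.Perm.sign_prodCongrRight]
  simp only [Finset.prod_const, Finset.card_univ, Fintype.card_fin]
  rw [pow_succ, Int.units_sq, one_mul]

theorem mem_EGroup_succ_succ {m : ℕ} {σ : TreeAut 3 (m + 2)} :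
    σ ∈ EGroup 3 2 (m + 2) ↔ ∃ a b, (∀ i, a i ∈ EGroup 3 2 (m + 1)) ∧
      Equiv.Perm.sign b * ∏ i, Equiv.Perm.sign (top (a i)) = 1 ∧ σ = mk a b := by
  rw [EGroup, dif_pos (by omega), Subgroup.mem_inf, mem_wreathTop, MonoidHom.mem_ker]
  constructor
  · rintro ⟨⟨a, b, ha, rfl⟩, h⟩
    exact ⟨a, b, ha, by rwa [levelSgn_two] at h, rfl⟩
  · rintro ⟨a, b, ha, h, rfl⟩
    exact ⟨⟨a, b, ha, rfl⟩, by rwa [levelSgn_two]⟩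

theorem mk_mem_EGroup {m : ℕ} {a : Fin 3 → TreeAut 3 (m + 1)} {b : Equiv.Perm (Fin 3)} :
    mk a b ∈ EGroup 3 2 (m + 2) ↔ (∀ i, a i ∈ EGroup 3 2 (m + 1)) ∧
      Equiv.Perm.sign b * ∏ i, Equiv.Perm.sign (top (a i)) = 1 := by
  rw [mem_EGroup_succ_succ]
  constructor
  · rintro ⟨a', b', h1, h2, h3⟩
    obtain ⟨rfl, rfl⟩ := mk_injective h3
    exact ⟨h1, h2⟩
  · rintro ⟨h1, h2⟩
    exact ⟨a, b, h1, h2, rfl⟩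

/-- The automorphism acting by `a i` below the vertex `i` of level one. -/
def diag : (Fin d → TreeAut d n) →* TreeAut d (n + 1) where
  toFun a := mk a 1
  map_one' := mk_one
  map_mul' a a' := by rw [mk_mul]; rfl

theorem diag_apply (a : Fin d → TreeAut d n) : diag a = mk a 1 := rfl

end TreeAut

/-! ### A Goursat lemma for subgroups of powers of a solvable group with a sign character. -/

section Goursat

open scoped commutatorElement

variable {E ι : Type*} [Group E]

/-- A subgroup of a solvable group contained in the join of its commutator subgroup and a normal
subgroup `R` is contained in `R`. -/
theorem Subgroup.le_of_le_commutator_sup [Group.IsSolvable E] {K R : Subgroup E} [R.Normal]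
    (h : K ≤ ⁅K, K⁆ ⊔ R) : K ≤ R := by
  have h1 : K.map (QuotientGroup.mk' R) ≤
      ⁅K.map (QuotientGroup.mk' R), K.map (QuotientGroup.mk' R)⁆ := by
    rw [← Subgroup.map_commutator]
    refine (Subgroup.map_mono h).trans ?_
    rw [Subgroup.map_sup, QuotientGroup.map_mk'_self, sup_bot_eq]
  have : Group.IsSolvable (E ⧸ R) := inferInstance
  have h2 : K.map (QuotientGroup.mk' R) = ⊥ := by
    by_contra hne
    exact (Group.IsSolvable.commutator_lt_of_ne_bot hne).not_ge h1
  rw [Subgroup.map_eq_bot_iff, QuotientGroup.ker_mk'] at h2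
  exact h2

/-- The elements of `M` trivial at `j` project at `i` onto a normal subgroup `R` of `E`. Commutators
with an element of `N` that is odd at `i` but even at `j` show that `ker s` is contained in its own
commutator subgroup modulo `R`; solvability then gives `ker s ≤ R`. -/
theorem Subgroup.exists_apply_eq_and_apply_eq_one [Group.IsSolvable E] (s : E →* ℤˣ)
    (hs : s.ker ≤ ⁅s.ker, ⊤⁆) {M N : Subgroup (ι → E)}
    (hconj : ∀ ν ∈ N, ∀ μ ∈ M, ν * μ * ν⁻¹ ∈ M) {i j : ι}
    (hi : M.map (Pi.evalMonoidHom (fun _ => E) i) = s.ker)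
    (hj : M.map (Pi.evalMonoidHom (fun _ => E) j) = s.ker)
    (hN : ∀ x, ∃ ν ∈ N, ν i = x) (hν : ∃ ν ∈ N, s (ν i) = -1 ∧ s (ν j) = 1)
    {x : E} (hx : s x = 1) : ∃ μ ∈ M, μ i = x ∧ μ j = 1 := by
  set ei := Pi.evalMonoidHom (fun _ : ι => E) i with hei
  set ej := Pi.evalMonoidHom (fun _ : ι => E) j with hej
  set R : Subgroup E := (M ⊓ ej.ker).map ei with hR
  have hRn : R.Normal := by
    refine ⟨?_⟩
    rintro _ ⟨μ, ⟨hμ, hμj⟩, rfl⟩ g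
    obtain ⟨ν, hν, rfl⟩ := hN g
    refine ⟨ν * μ * ν⁻¹, ⟨hconj ν hν μ hμ, ?_⟩, rfl⟩
    have : μ j = 1 := hμj
    change ν j * μ j * (ν j)⁻¹ = 1
    rw [this, mul_one, mul_inv_cancel]
  have key : s.ker ≤ ⁅s.ker, s.ker⁆ ⊔ R := by
    refine hs.trans ?_
    have hQ : (⁅s.ker, s.ker⁆ ⊔ R).Normal := inferInstance
    rw [Subgroup.commutator_le]
    intro x hx t _
    obtain ⟨ν, hνN, hνi, hνj⟩ := hν
    obtain ⟨μ, hμ, hμx⟩ : x ∈ M.map ei := hi ▸ hx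
    have hodd : ⁅x, ν i⁆ ∈ ⁅s.ker, s.ker⁆ ⊔ R := by
      have hθ : ⁅μ, ν⁆ ∈ M := by
        have := M.mul_mem hμ (hconj ν hνN μ⁻¹ (M.inv_mem hμ))
        rwa [commutatorElement_def, mul_assoc, mul_assoc, ← mul_assoc ν]
      have hθj : ⁅μ, ν⁆ j ∈ ⁅s.ker, s.ker⁆ := by
        change ⁅μ j, ν j⁆ ∈ _
        exact Subgroup.commutator_mem_commutator (hj ▸ ⟨μ, hμ, rfl⟩) hνj
      -- Since `ν j` is even, the `j`-coordinate of `⁅μ, ν⁆` can be cancelled by an element of `⁅M,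
      -- M⁆`, which at `i` costs only an element of `⁅ker s, ker s⁆`.
      obtain ⟨θ', hθ', hθ'j⟩ : ⁅μ, ν⁆ j ∈ (⁅M, M⁆).map ej := by
        rwa [Subgroup.map_commutator, hj]
      have hθ'i : θ' i ∈ ⁅s.ker, s.ker⁆ := by
        have : ei θ' ∈ (⁅M, M⁆).map ei := ⟨θ', hθ', rfl⟩
        rwa [Subgroup.map_commutator, hi] at this
      have hθ'M : θ' ∈ M := (Subgroup.commutator_le_self M) hθ'
      have h1 : (⁅μ, ν⁆ * θ'⁻¹) i ∈ R := by
        refine ⟨⁅μ, ν⁆ * θ'⁻¹, ⟨M.mul_mem hθ (M.inv_mem hθ'M), ?_⟩, rfl⟩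
        change ⁅μ, ν⁆ j * (θ' j)⁻¹ = 1
        have : θ' j = ⁅μ, ν⁆ j := hθ'j
        rw [this, mul_inv_cancel]
      have h2 : ⁅x, ν i⁆ = (⁅μ, ν⁆ * θ'⁻¹) i * θ' i := by
        have : μ i = x := hμx
        rw [← this]
        change ⁅μ, ν⁆ i = ⁅μ, ν⁆ i * (θ' i)⁻¹ * θ' i
        group
      rw [h2]
      exact Subgroup.mul_mem _ (Subgroup.mem_sup_right h1) (Subgroup.mem_sup_left hθ'i)
    rcases Int.units_eq_one_or (s t) with ht | ht
    · exact Subgroup.mem_sup_left (Subgroup.commutator_mem_commutator hx ht)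
    · have hκ : t * (ν i)⁻¹ ∈ s.ker := by
        rw [MonoidHom.mem_ker, map_mul, map_inv, ht, hνi]
        rfl
      -- An odd `t` differs from `ν i` by an even factor, so the previous case suffices up to
      -- conjugation.
      have e : ⁅x, t⁆ = ⁅x, t * (ν i)⁻¹⁆ *
          ((t * (ν i)⁻¹) * ⁅x, ν i⁆ * (t * (ν i)⁻¹)⁻¹) := by
        simp only [commutatorElement_def]
        group
      rw [e]
      exact Subgroup.mul_mem _
        (Subgroup.mem_sup_left (Subgroup.commutator_mem_commutator hx hκ))
        (hQ.conj_mem _ hodd _)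
  obtain ⟨μ, ⟨hμ, hμj⟩, hμx⟩ := Subgroup.le_of_le_commutator_sup key hx
  exact ⟨μ, hμ, hμx, hμj⟩

/-- The pairwise lemma is used twice: first to make one of the two other coordinates trivial, then,
inside the subgroup where it is trivial, to kill the remaining one. -/
theorem Subgroup.mulSingle_mem_of_sign_patterns [Group.IsSolvable E] (s : E →* ℤˣ)
    (hs : s.ker ≤ ⁅s.ker, ⊤⁆) {N : Subgroup (Fin 3 → E)} (hN : ∀ i x, ∃ ν ∈ N, ν i = x)
    (hν : ∀ i j, i ≠ j → ∃ ν ∈ N, s (ν i) = -1 ∧ s (ν j) = 1)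
    (i : Fin 3) {x : E} (hx : s x = 1) : Pi.mulSingle i x ∈ N := by
  set e : ∀ i, (Fin 3 → E) →* E := fun i => Pi.evalMonoidHom (fun _ : Fin 3 => E) i with he
  set M : Subgroup (Fin 3 → E) := N ⊓ ⨅ i, (s.comp (e i)).ker with hM
  have hMmem : ∀ μ, μ ∈ M ↔ μ ∈ N ∧ ∀ i, s (μ i) = 1 := by
    intro μ
    simp only [hM, Subgroup.mem_inf, Subgroup.mem_iInf, MonoidHom.mem_ker]
    rfl
  have hMN : M ≤ N := inf_le_left
  have hconj : ∀ ν ∈ N, ∀ μ ∈ M, ν * μ * ν⁻¹ ∈ M := by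
    intro ν hν μ hμ
    rw [hMmem] at hμ ⊢
    refine ⟨N.mul_mem (N.mul_mem hν hμ.1) (N.inv_mem hν), fun i => ?_⟩
    change s (ν i * μ i * (ν i)⁻¹) = 1
    rw [map_mul, map_mul, hμ.2, mul_one, ← map_mul, mul_inv_cancel, map_one]
  have hNtop : ∀ i, N.map (e i) = ⊤ := by
    intro i
    rw [eq_top_iff]
    intro x _
    obtain ⟨ν, h, rfl⟩ := hN i x
    exact ⟨ν, h, rfl⟩
  have hMi : ∀ i, M.map (e i) = s.ker := by
    intro i
    apply le_antisymm
    · rintro _ ⟨μ, hμ, rfl⟩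
      exact ((hMmem μ).1 hμ).2 i
    -- Commutators of elements of `N` are even in every coordinate, so `M` projects onto at least
    -- `⁅E, E⁆`, which contains `ker s`.
    · refine hs.trans ?_
      refine (Subgroup.commutator_mono le_top le_rfl).trans ?_
      rw [← hNtop i, ← Subgroup.map_commutator]
      refine Subgroup.map_mono ?_
      rw [Subgroup.commutator_le]
      intro x hx y hy
      rw [hMmem]
      refine ⟨N.commutator_le_self (Subgroup.commutator_mem_commutator hx hy), fun i => ?_⟩
      change s ⁅x i, y i⁆ = 1
      rw [map_commutatorElement, commutatorElement_eq_one_iff_mul_comm, mul_comm]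
  have hpair : ∀ i j, i ≠ j → ∀ x, s x = 1 → ∃ μ ∈ M, μ i = x ∧ μ j = 1 :=
    fun i j hij x hx => Subgroup.exists_apply_eq_and_apply_eq_one s hs hconj (hMi i) (hMi j)
      (hN i) (hν i j hij) hx
  obtain ⟨j, k, hij, hik, hjk, hall⟩ : ∃ j k : Fin 3, i ≠ j ∧ i ≠ k ∧ j ≠ k ∧
      ∀ l, l = i ∨ l = j ∨ l = k := by
    revert i; decide
  have hmap : ∀ l, l ≠ j → (M ⊓ (e j).ker).map (e l) = s.ker := by
    intro l hl
    apply le_antisymm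
    · rintro _ ⟨μ, hμ, rfl⟩
      exact ((hMmem μ).1 hμ.1).2 l
    · intro x hx
      obtain ⟨μ, h1, h2, h3⟩ := hpair l j hl x hx
      exact ⟨μ, ⟨h1, h3⟩, h2⟩
  obtain ⟨μ, hμ, hμi, hμk⟩ := Subgroup.exists_apply_eq_and_apply_eq_one s hs
    (M := M ⊓ (e j).ker) (by
      rintro ν hν μ ⟨hμ, hμj⟩
      refine ⟨hconj ν hν μ hμ, ?_⟩
      have : μ j = 1 := hμj
      change ν j * μ j * (ν j)⁻¹ = 1
      rw [this, mul_one, mul_inv_cancel])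
    (hmap i hij) (hmap k hjk.symm) (hN i) (hν i k hik) hx
  convert hMN hμ.1
  funext l
  rcases hall l with rfl | rfl | rfl
  · rw [Pi.mulSingle_eq_same, hμi]
  · rw [Pi.mulSingle_eq_of_ne hij.symm]
    exact hμ.2.symm
  · rw [Pi.mulSingle_eq_of_ne hik.symm, hμk]

end Goursat

/-! ### Solvability of the groups `E_n` and commutators of their even parts. -/

namespace TreeAut

section EGroup

open scoped commutatorElement

theorem perm_fin_three_commutator : ∀ c : Equiv.Perm (Fin 3), Equiv.Perm.sign c = 1 →
    ∃ c' t : Equiv.Perm (Fin 3), Equiv.Perm.sign c' = 1 ∧ Equiv.Perm.sign t = -1 ∧ ⁅c', t⁆ = c := by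
  simp only [commutatorElement_def]
  decide

instance isSolvable_perm_fin_three : Group.IsSolvable (Equiv.Perm (Fin 3)) := by
  have : Group.IsSolvable (Equiv.Perm.sign (α := Fin 3)).ker := by
    refine Group.isSolvable_of_comm fun a b => Subtype.ext ?_
    have : ∀ a b : Equiv.Perm (Fin 3), Equiv.Perm.sign a = 1 → Equiv.Perm.sign b = 1 →
      a * b = b * a := by decide
    exact this a b a.2 b.2
  exact Group.isSolvable_of_ker_le_range (Equiv.Perm.sign (α := Fin 3)).ker.subtype
    (Equiv.Perm.sign (α := Fin 3)) (by simp)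

theorem isSolvable_wreathTop {n : ℕ} (H : Subgroup (TreeAut 3 n)) [Group.IsSolvable H] :
    Group.IsSolvable (wreathTop H) := by
  have : Group.IsSolvable (Fin 3 → H) := by
    refine Group.isSolvable_of_isSolvable_injective (G' := H × H × H) (f :=
      (Pi.evalMonoidHom (fun _ => H) 0).prod
        ((Pi.evalMonoidHom (fun _ => H) 1).prod (Pi.evalMonoidHom (fun _ => H) 2))) ?_
    intro x y h
    simp only [MonoidHom.prod_apply, Prod.mk.injEq] at h
    funext i
    fin_cases i
    exacts [h.1, h.2.1, h.2.2]
  refine Group.isSolvable_of_ker_le_range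
    ((diag.comp (H.subtype.compLeft (Fin 3))).codRestrict (wreathTop H) fun a =>
      mem_wreathTop.2 ⟨_, 1, fun i => (a i).2, rfl⟩)
    (top.comp (wreathTop H).subtype) ?_
  rintro ⟨σ, hσ⟩ h1
  obtain ⟨a, b, ha, rfl⟩ := mem_wreathTop.1 hσ
  have hb : b = 1 := (top_mk a b).symm.trans h1
  subst hb
  exact ⟨fun i => ⟨a i, ha i⟩, rfl⟩

theorem isSolvable_EGroup : ∀ n, Group.IsSolvable (EGroup 3 2 (n + 1))
  | 0 => by
    refine Group.isSolvable_of_isSolvable_injective (f := top.comp (EGroup 3 2 1).subtype) ?_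
    intro σ τ h
    refine Subtype.ext ?_
    rw [eq_mk_top σ.1, eq_mk_top τ.1]
    exact congrArg _ h
  | n + 1 => by
    have := isSolvable_EGroup n
    have := isSolvable_wreathTop (EGroup 3 2 (n + 1))
    have hle : EGroup 3 2 (n + 2) ≤ wreathTop (EGroup 3 2 (n + 1)) := by
      intro σ hσ
      obtain ⟨a, b, h1, -, h2⟩ := mem_EGroup_succ_succ.1 hσ
      exact mem_wreathTop.2 ⟨a, b, h1, h2⟩
    exact Group.isSolvable_of_isSolvable_injective (Subgroup.inclusion_injective hle)

theorem exists_mem_EGroup_top_eq : ∀ (n : ℕ) (b : Equiv.Perm (Fin 3)),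
    ∃ σ ∈ EGroup 3 2 (n + 1), top σ = b
  | 0, b => ⟨mk 1 b, trivial, top_mk _ _⟩
  | n + 1, b => by
    obtain ⟨u, hu, hub⟩ := exists_mem_EGroup_top_eq n b
    refine ⟨mk (Pi.mulSingle 0 u) b, mk_mem_EGroup.2 ⟨fun i => ?_, ?_⟩, top_mk _ _⟩
    · rw [Pi.mulSingle_apply]
      split_ifs
      exacts [hu, one_mem _]
    · simp [Fin.prod_univ_three, hub, Int.units_mul_self]

/-- The automorphisms in `E_n` that induce an even permutation of the first level. -/
def evenEGroup (n : ℕ) : Subgroup (TreeAut 3 (n + 1)) :=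
  EGroup 3 2 (n + 1) ⊓ (Equiv.Perm.sign.comp top).ker

theorem mem_evenEGroup {n : ℕ} {σ : TreeAut 3 (n + 1)} :
    σ ∈ evenEGroup n ↔ σ ∈ EGroup 3 2 (n + 1) ∧ Equiv.Perm.sign (top σ) = 1 := Iff.rfl

theorem diag_mem_of_mulSingle_mem {n : ℕ} {U : Subgroup (TreeAut 3 (n + 1))}
    {a : Fin 3 → TreeAut 3 n} (h : ∀ i, diag (Pi.mulSingle i (a i)) ∈ U) : diag a ∈ U := by
  have : a = Pi.mulSingle 0 (a 0) * Pi.mulSingle 1 (a 1) * Pi.mulSingle 2 (a 2) := by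
    funext i
    fin_cases i <;> simp
  rw [this, map_mul, map_mul]
  exact U.mul_mem (U.mul_mem (h 0) (h 1)) (h 2)

/-- Supplies the hypothesis on `ker s` in the Goursat lemma. By induction the commutator subgroup
contains the even elements supported on one coordinate; commutators with a 3-cycle realize the
remaining sign patterns, and `A_3 = [A_3, S_3]` handles the action on level one. -/
theorem evenEGroup_le_commutator : ∀ n, evenEGroup n ≤ ⁅evenEGroup n, EGroup 3 2 (n + 1)⁆
  | 0 => by
    intro σ hσ
    obtain ⟨c', t, hc', -, hc⟩ := perm_fin_three_commutator _ hσ.2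
    have : σ = ⁅(mk 1 c' : TreeAut 3 1), (mk 1 t : TreeAut 3 1)⁆ := by
      rw [eq_mk_top ⁅_, _⁆, map_commutatorElement, top_mk, top_mk, hc]
      exact eq_mk_top σ
    rw [this]
    exact Subgroup.commutator_mem_commutator
      (mem_evenEGroup.2 ⟨trivial, by rwa [top_mk]⟩) trivial
  | n + 1 => by
    set U := ⁅evenEGroup (n + 1), EGroup 3 2 (n + 2)⁆ with hU
    have hsingle : ∀ i, ∀ x ∈ evenEGroup n, diag (Pi.mulSingle i x) ∈ U := by
      intro i
      change evenEGroup n ≤ U.comap (diag.comp (MonoidHom.mulSingle _ i))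
      refine (evenEGroup_le_commutator n).trans ?_
      rw [Subgroup.commutator_le]
      intro x hx s hs
      obtain ⟨j, hij⟩ : ∃ j, i ≠ j := ⟨i + 1, by revert i; decide⟩
      -- The second copy of `s`, at `j`, makes the signs multiply to 1, so that the element lies in
      -- `E`; it does not affect the commutator because `x` is supported at `i`.
      have e : diag (Pi.mulSingle i ⁅x, s⁆) =
          ⁅diag (Pi.mulSingle i x), diag (fun l => if l = i ∨ l = j then s else 1)⁆ := by
        rw [← map_commutatorElement]
        congr 1
        funext l
        change _ = ⁅(Pi.mulSingle i x : Fin 3 → TreeAut 3 (n + 1)) l, if l = i ∨ l = j then s else 1⁆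
        by_cases hl : l = i
        · subst hl
          simp
        · simp [Pi.mulSingle_eq_of_ne hl, commutatorElement_def]
      change diag (Pi.mulSingle i ⁅x, s⁆) ∈ U
      rw [e]
      refine Subgroup.commutator_mem_commutator (mem_evenEGroup.2 ⟨mk_mem_EGroup.2 ⟨fun l => ?_, ?_⟩,
        ?_⟩) (mk_mem_EGroup.2 ⟨fun l => ?_, ?_⟩)
      · rw [Pi.mulSingle_apply]
        split_ifs
        exacts [hx.1, one_mem _]
      · rw [map_one, one_mul]
        refine Finset.prod_eq_one fun l _ => ?_
        rw [Pi.mulSingle_apply]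
        split_ifs
        exacts [hx.2, by simp]
      · rw [diag_apply, top_mk, map_one]
      · split_ifs
        exacts [hs, one_mem _]
      · have h2 : Equiv.Perm.sign (top s) * Equiv.Perm.sign (top s) = 1 := Int.units_mul_self _
        clear e
        revert i j
        simp only [Fin.prod_univ_three]
        intro i j hij
        fin_cases i <;> fin_cases j <;> simp_all
    have hdiag : ∀ a : Fin 3 → TreeAut 3 (n + 1), diag a ∈ EGroup 3 2 (n + 2) → diag a ∈ U := by
      intro a ha
      have ha' := mk_mem_EGroup.1 ha
      have h3 : Equiv.Perm.sign (finRotate 3) = 1 := by decide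
      set r : TreeAut 3 (n + 2) := mk 1 (finRotate 3) with hr
      have hrE : r ∈ evenEGroup (n + 1) :=
        mem_evenEGroup.2 ⟨mk_mem_EGroup.2 ⟨fun _ => one_mem _, by simp [h3]⟩, by rwa [top_mk]⟩
      set e : TreeAut 3 (n + 2) := diag (fun i => a ((finRotate 3)⁻¹ i)) with he
      have heE : e ∈ EGroup 3 2 (n + 2) := by
        refine mk_mem_EGroup.2 ⟨fun i => ha'.1 _, ?_⟩
        rw [← ha'.2]
        congr 1
        exact Equiv.prod_comp (finRotate 3)⁻¹ fun i => Equiv.Perm.sign (top (a i))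
      -- The sign of this commutator at `i` is the product of the signs of `a` at the two other
      -- coordinates. As all three signs multiply to 1, it equals the sign of `a i`, so `diag a *
      -- ⁅r, e⁆⁻¹` is even in every coordinate.
      have hc : ⁅r, e⁆ = diag fun i =>
          a ((finRotate 3)⁻¹ ((finRotate 3)⁻¹ i)) * (a ((finRotate 3)⁻¹ i))⁻¹ := by
        rw [commutatorElement_def, he, ← map_inv, diag_apply, diag_apply, diag_apply, hr, mk_inv,
          mk_mul, mk_mul, mk_mul]
        rw [mul_one, mul_one, mul_inv_cancel]
        congr 1
      have hcU : ⁅r, e⁆ ∈ U := Subgroup.commutator_mem_commutator hrE heE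
      have hprod := ha'.2
      rw [map_one, one_mul, Fin.prod_univ_three] at hprod
      rw [← mul_inv_cancel_right (diag a) ⁅r, e⁆⁻¹]
      refine U.mul_mem ?_ (by rwa [inv_inv])
      rw [hc, ← map_inv, ← map_mul]
      refine diag_mem_of_mulSingle_mem fun i => hsingle i _ (mem_evenEGroup.2 ⟨?_, ?_⟩)
      · exact Subgroup.mul_mem _ (ha'.1 _) (Subgroup.inv_mem _
          (Subgroup.mul_mem _ (ha'.1 _) (Subgroup.inv_mem _ (ha'.1 _))))
      · have h0 : (finRotate 3)⁻¹ (0 : Fin 3) = 2 := by decide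
        have h1 : (finRotate 3)⁻¹ (1 : Fin 3) = 0 := by decide
        have h2 : (finRotate 3)⁻¹ (2 : Fin 3) = 1 := by decide
        simp only [Pi.mul_apply, Pi.inv_apply, map_mul, map_inv, Int.units_inv_eq_self]
        revert hprod
        fin_cases i <;> simp only [Fin.zero_eta, Fin.mk_one, Fin.reduceFinMk, h0, h1, h2] <;>
          generalize Equiv.Perm.sign (top (a 0)) = x <;>
          generalize Equiv.Perm.sign (top (a 1)) = y <;>
          generalize Equiv.Perm.sign (top (a 2)) = z <;> revert x y z <;> decide
    intro σ hσ
    obtain ⟨a, b, -, -, rfl⟩ := mem_EGroup_succ_succ.1 hσ.1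
    have hb := (mem_evenEGroup.1 hσ).2
    rw [top_mk] at hb
    obtain ⟨c', t, hc', -, hc⟩ := perm_fin_three_commutator b hb
    obtain ⟨τ, hτ, rfl⟩ := exists_mem_EGroup_top_eq (n + 1) t
    obtain ⟨γ, hγ, rfl⟩ := exists_mem_EGroup_top_eq (n + 1) c'
    have hθ : ⁅γ, τ⁆ ∈ U := Subgroup.commutator_mem_commutator (mem_evenEGroup.2 ⟨hγ, hc'⟩) hτ
    have hθE : ⁅γ, τ⁆ ∈ EGroup 3 2 (n + 2) := by
      rw [commutatorElement_def]
      exact Subgroup.mul_mem _ (Subgroup.mul_mem _ (Subgroup.mul_mem _ hγ hτ)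
        (Subgroup.inv_mem _ hγ)) (Subgroup.inv_mem _ hτ)
    have hE := Subgroup.mul_mem _ hσ.1 (Subgroup.inv_mem _ hθE)
    obtain ⟨a', b', -, -, h⟩ := mem_EGroup_succ_succ.1 hE
    have hb' : b' = 1 := by
      have h1 := congrArg top h
      rw [map_mul, map_inv, map_commutatorElement, hc, top_mk, top_mk, mul_inv_cancel] at h1
      exact h1.symm
    subst hb'
    rw [h] at hE
    rw [← inv_mul_cancel_right (mk a b) ⁅γ, τ⁆]
    refine Subgroup.mul_mem _ ?_ hθ
    rw [h]
    exact hdiag a' hE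

end EGroup

end TreeAut

/-! ### A generation criterion for `E_n`. -/

namespace TreeAut

section Generation

open scoped commutatorElement

variable {m : ℕ}

theorem exists_sign_ne : ∀ p : Fin 3 → ℤˣ, ∏ i, p i = 1 → (¬ ∀ i, p i = 1) →
    ∃ i j, i ≠ j ∧ p i = -1 ∧ p j = 1 := by
  decide

theorem sign_eq_of_prod_eq_one (p q : Fin 3 → ℤˣ) (hp : ∏ i, p i = 1) (hq : ∏ i, q i = 1)
    (i j : Fin 3) (hij : i ≠ j) (hi : p i = q i) (hj : p j = q j) : p = q := by
  obtain ⟨k, h⟩ : ∃ k : Fin 3, (Finset.univ : Finset (Fin 3)) = {i, j, k} ∧ k ≠ i ∧ k ≠ j := by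
    clear hi hj
    revert i j
    decide
  rw [h.1, Finset.prod_insert (by simp [hij, h.2.1.symm]), Finset.prod_pair h.2.2.symm] at hp hq
  have hk : p k = q k := by
    rw [← hq, hi, hj] at hp
    exact mul_left_cancel (mul_left_cancel hp)
  funext l
  have hl := Finset.mem_univ l
  rw [h.1] at hl
  simp only [Finset.mem_insert, Finset.mem_singleton] at hl
  rcases hl with rfl | rfl | rfl
  exacts [hi, hj, hk]

/-- If the element from `h3` swaps 1 and 2, then its section at 0 is even. An element fixing 0 with
odd section there either already has `b = 1` or can be multiplied with it to undo the swap while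
keeping the section odd. -/
theorem exists_diag_mem_of_odd {G : Subgroup (TreeAut 3 (m + 2))}
    (h1 : ∀ τ ∈ EGroup 3 2 (m + 1), ∃ a b, mk a b ∈ G ∧ b 0 = 0 ∧ a 0 = τ)
    (h3 : ∃ a b, mk a b ∈ G ∧ b 0 = 0 ∧ Equiv.Perm.sign b * Equiv.Perm.sign (top (a 0)) = -1) :
    ∃ a, diag a ∈ G ∧ Equiv.Perm.sign (top (a 0)) = -1 := by
  obtain ⟨a, b, hG, hb, hs⟩ := h3
  have hperm : ∀ b : Equiv.Perm (Fin 3), b 0 = 0 → b = 1 ∨ b = Equiv.swap 1 2 := by decide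
  have hswap : Equiv.Perm.sign (Equiv.swap (1 : Fin 3) 2) = -1 := by decide
  rcases hperm b hb with rfl | rfl
  · exact ⟨a, hG, by simpa using hs⟩
  · obtain ⟨τ, hτ, hτs⟩ := exists_mem_EGroup_top_eq m (Equiv.swap 1 2)
    obtain ⟨a', b', hG', hb', rfl⟩ := h1 τ hτ
    rcases hperm b' hb' with rfl | rfl
    · exact ⟨a', hG', by rw [hτs, hswap]⟩
    · refine ⟨fun i => a (Equiv.swap 1 2 i) * a' i, ?_, ?_⟩
      · have := G.mul_mem hG hG'
        rwa [mk_mul, Equiv.swap_mul_self] at this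
      · rw [map_mul, map_mul, hτs, hb, mul_comm]
        exact hs

/-- The work is to show that the part `N` of `G` fixing level one meets the hypotheses of the
Goursat lemma. Then `G` contains every diagonal element with even sections, every admissible sign
pattern comes from `N`, and `h2` supplies the action on level one. -/
theorem EGroup_le_of_generation {G : Subgroup (TreeAut 3 (m + 2))} (hGE : G ≤ EGroup 3 2 (m + 2))
    (h1 : ∀ i, ∀ τ ∈ EGroup 3 2 (m + 1), ∃ a b, mk a b ∈ G ∧ b i = i ∧ a i = τ)
    (h2 : ∀ b, ∃ a, mk a b ∈ G)
    (h3 : ∃ a b, mk a b ∈ G ∧ b 0 = 0 ∧ Equiv.Perm.sign b * Equiv.Perm.sign (top (a 0)) = -1) :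
    EGroup 3 2 (m + 2) ≤ G := by
  have hsolv := isSolvable_EGroup m
  set E := EGroup 3 2 (m + 1) with hE
  set s : E →* ℤˣ := (Equiv.Perm.sign.comp top).comp E.subtype with hs
  set N : Subgroup (Fin 3 → E) := G.comap (diag.comp (E.subtype.compLeft (Fin 3))) with hN
  have hNmem : ∀ ν : Fin 3 → E, ν ∈ N ↔ diag (fun i => (ν i : TreeAut 3 (m + 1))) ∈ G :=
    fun _ => Iff.rfl
  have hGa : ∀ {a b}, mk a b ∈ G → ∀ i, a i ∈ E := fun h => (mk_mem_EGroup.1 (hGE h)).1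
  have hsker : s.ker ≤ ⁅s.ker, ⊤⁆ := by
    have h : s.ker.map E.subtype = evenEGroup m := by
      ext σ
      constructor
      · rintro ⟨τ, h, rfl⟩
        exact ⟨τ.2, h⟩
      · rintro ⟨h, h'⟩
        exact ⟨⟨σ, h⟩, h', rfl⟩
    rw [← Subgroup.map_subtype_le_map_subtype, Subgroup.map_commutator, h, ← MonoidHom.range_eq_map,
      Subgroup.range_subtype]
    exact evenEGroup_le_commutator m
  have hconj : ∀ {a a' b}, mk a' b ∈ G → diag a ∈ G →
      diag (fun i => a' (b⁻¹ i) * a (b⁻¹ i) * (a' (b⁻¹ i))⁻¹) ∈ G := by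
    intro a a' b h' h
    have := G.mul_mem (G.mul_mem h' h) (G.inv_mem h')
    rw [diag_apply, mk_inv, mk_mul, mk_mul, mul_one, mul_inv_cancel] at this
    exact this
  have hpat : ∀ i j, i ≠ j → ∃ ν ∈ N, s (ν i) = -1 ∧ s (ν j) = 1 := by
    obtain ⟨a, ha, ha0⟩ := exists_diag_mem_of_odd (h1 0) h3
    have hprod := (mk_mem_EGroup.1 (hGE ha)).2
    -- The three signs multiply to 1 and the one at 0 is odd, so one of the other two is even;
    -- conjugation then moves `(0, j₀)` to any pair `(i, j)`.
    obtain ⟨j₀, hj₀, hj₀s⟩ : ∃ j₀ : Fin 3, j₀ ≠ 0 ∧ Equiv.Perm.sign (top (a j₀)) = 1 := by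
      rw [map_one, one_mul, Fin.prod_univ_three, ha0] at hprod
      rcases Int.units_eq_one_or (Equiv.Perm.sign (top (a 1))) with h | h
      · exact ⟨1, by decide, h⟩
      · exact ⟨2, by decide, by simpa [h] using hprod⟩
    intro i j hij
    obtain ⟨b, hbi, hbj⟩ : ∃ b : Equiv.Perm (Fin 3), b⁻¹ i = 0 ∧ b⁻¹ j = j₀ := by
      clear hj₀s
      revert i j j₀
      decide
    obtain ⟨a', ha'⟩ := h2 b
    have h := hconj ha' ha
    refine ⟨fun i => ⟨_, hGa h i⟩, h, ?_, ?_⟩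
    · change Equiv.Perm.sign (top (a' (b⁻¹ i) * a (b⁻¹ i) * (a' (b⁻¹ i))⁻¹)) = -1
      rw [hbi, map_mul, map_mul, map_mul, map_mul, map_inv, map_inv, ha0, mul_comm,
        inv_mul_cancel_left]
    · change Equiv.Perm.sign (top (a' (b⁻¹ j) * a (b⁻¹ j) * (a' (b⁻¹ j))⁻¹)) = 1
      rw [hbj, map_mul, map_mul, map_mul, map_mul, map_inv, map_inv, hj₀s, mul_comm,
        inv_mul_cancel_left]
  have hsurj : ∀ i x, ∃ ν ∈ N, ν i = x := by
    intro i
    set P := N.map (Pi.evalMonoidHom (fun _ => E) i) with hP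
    have hker : s.ker ≤ P := by
      refine (hsker.trans (Subgroup.commutator_mono le_top le_rfl)).trans ?_
      rw [Subgroup.commutator_le]
      rintro ⟨x, hx⟩ - ⟨y, hy⟩ -
      obtain ⟨a, b, hG, hb, rfl⟩ := h1 i x hx
      obtain ⟨a', b', hG', hb', rfl⟩ := h1 i y hy
      -- Point stabilizers in `S_3` are abelian, so commutators of elements fixing `i` act trivially
      -- on level one and lie in `N`.
      have hcomm : ∀ (i : Fin 3) (b b' : Equiv.Perm (Fin 3)), b i = i → b' i = i →
        b * b' = b' * b := by decide
      have hbb := hcomm i b b' hb hb'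
      have h : ⁅mk a b, mk a' b'⁆ ∈ G :=
        G.commutator_le_self (Subgroup.commutator_mem_commutator hG hG')
      have hbi : b⁻¹ i = i := by rw [Equiv.Perm.inv_eq_iff_eq, hb]
      have hbi' : b'⁻¹ i = i := by rw [Equiv.Perm.inv_eq_iff_eq, hb']
      rw [commutatorElement_def, mk_inv, mk_inv, mk_mul, mk_mul, mk_mul, hbb, mul_inv_cancel_right,
        mul_inv_cancel] at h
      refine ⟨fun l => ⟨_, hGa h l⟩, h, Subtype.ext ?_⟩
      change a (b' (b⁻¹ (b'⁻¹ i))) * a' (b⁻¹ (b'⁻¹ i)) * (a (b⁻¹ (b'⁻¹ i)))⁻¹ *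
        (a' (b'⁻¹ i))⁻¹ = a i * a' i * (a i)⁻¹ * (a' i)⁻¹
      rw [hbi', hbi, hb']
    intro x
    rcases Int.units_eq_one_or (s x) with hx | hx
    · exact hker hx
    · obtain ⟨ν, hν, hνi, -⟩ := hpat i (i + 1) (by simp)
      obtain ⟨μ, hμ, hμi⟩ : x * (ν i)⁻¹ ∈ P := hker (by
        rw [MonoidHom.mem_ker, map_mul, map_inv, hx, hνi]; rfl)
      refine ⟨μ * ν, N.mul_mem hμ hν, ?_⟩
      have : μ i = x * (ν i)⁻¹ := hμi
      rw [Pi.mul_apply, this, inv_mul_cancel_right]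
  have hsingle : ∀ i, ∀ x ∈ E, Equiv.Perm.sign (top x) = 1 → diag (Pi.mulSingle i x) ∈ G := by
    intro i x hx hxs
    have := (hNmem _).1 (Subgroup.mulSingle_mem_of_sign_patterns s hsker hsurj hpat i
      (x := ⟨x, hx⟩) hxs)
    convert this using 2
    funext l
    by_cases hl : l = i
    · subst hl; simp
    · simp [Pi.mulSingle_eq_of_ne hl]
  have heven : ∀ a, diag a ∈ EGroup 3 2 (m + 2) → (∀ i, Equiv.Perm.sign (top (a i)) = 1) →
      diag a ∈ G := fun a ha hev =>
    diag_mem_of_mulSingle_mem fun i => hsingle i _ ((mk_mem_EGroup.1 ha).1 i) (hev i)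
  have hdiag : ∀ a, diag a ∈ EGroup 3 2 (m + 2) → diag a ∈ G := by
    intro a ha
    by_cases hev : ∀ i, Equiv.Perm.sign (top (a i)) = 1
    · exact heven a ha hev
    obtain ⟨ν, hν, hνa⟩ : ∃ ν ∈ N, ∀ i, s (ν i) = Equiv.Perm.sign (top (a i)) := by
      have hprod := (mk_mem_EGroup.1 ha).2
      rw [map_one, one_mul] at hprod
      obtain ⟨i, j, hij, hi, hj⟩ := exists_sign_ne _ hprod hev
      obtain ⟨ν, hν, hνi, hνj⟩ := hpat i j hij
      have hprod' := (mk_mem_EGroup.1 (hGE ((hNmem ν).1 hν))).2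
      rw [map_one, one_mul] at hprod'
      exact ⟨ν, hν, congrFun (sign_eq_of_prod_eq_one (fun i => s (ν i)) _ hprod' hprod i j hij
        (hνi.trans hi.symm) (hνj.trans hj.symm))⟩
    have hνE := hGE ((hNmem ν).1 hν)
    rw [← inv_mul_cancel_right (diag a) (diag fun i => (ν i : TreeAut 3 (m + 1)))]
    refine G.mul_mem ?_ ((hNmem ν).1 hν)
    have h := Subgroup.mul_mem _ ha (Subgroup.inv_mem _ hνE)
    rw [← map_inv, ← map_mul] at h ⊢
    refine heven _ h fun i => ?_
    have h' : Equiv.Perm.sign (top (ν i : TreeAut 3 (m + 1))) = _ := hνa i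
    rw [Pi.mul_apply, Pi.inv_apply, map_mul, map_mul, map_inv, map_inv, h', mul_inv_cancel]
  intro σ hσ
  obtain ⟨a, b, -, -, rfl⟩ := mem_EGroup_succ_succ.1 hσ
  obtain ⟨a', hG⟩ := h2 b
  rw [← inv_mul_cancel_right (mk a b) (mk a' b)]
  refine G.mul_mem ?_ hG
  have h := Subgroup.mul_mem _ hσ (Subgroup.inv_mem _ (hGE hG))
  rw [mk_inv, mk_mul, mul_inv_cancel] at h ⊢
  exact hdiag _ h

end Generation

end TreeAut

/-! ### Fibres of the cubic, their discriminants, and coherent labelings of the preimage tree. -/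

section Labelings

variable {Ω : Type*} [Field Ω]

/-- The map `x ↦ 2 x ^ 3 - 3 x ^ 2 + 1`. -/
def cubicMap (x : Ω) : Ω := 2 * x ^ 3 - 3 * x ^ 2 + 1

theorem cubicMap_eq (x : Ω) : cubicMap x = 2 * x ^ 3 - 3 * x ^ 2 + 1 := rfl

/-- The Vandermonde product of a triple. -/
def vandermondeThree (c : Fin 3 → Ω) : Ω := (Matrix.vandermonde c).det

theorem vandermondeThree_eq (c : Fin 3 → Ω) :
    vandermondeThree c = (c 1 - c 0) * (c 2 - c 0) * (c 2 - c 1) := by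
  rw [vandermondeThree, Matrix.det_fin_three]
  simp [Matrix.vandermonde_apply]
  ring

theorem vandermondeThree_comp (c : Fin 3 → Ω) (b : Equiv.Perm (Fin 3)) :
    vandermondeThree (c ∘ b) = ((Equiv.Perm.sign b : ℤˣ) : ℤ) * vandermondeThree c := by
  rw [vandermondeThree, vandermondeThree, ← Matrix.det_permute]
  rfl

theorem map_vandermondeThree {G : Type*} [FunLike G Ω Ω] [RingHomClass G Ω Ω] (g : G)
    (c : Fin 3 → Ω) : g (vandermondeThree c) = vandermondeThree (fun i => g (c i)) := by
  simp only [vandermondeThree_eq, map_mul, map_sub]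

/-- The elementary symmetric functions of `c` are those of the preimages of `v` under the cubic
map. -/
structure IsFibre (v : Ω) (c : Fin 3 → Ω) : Prop where
  sum : c 0 + c 1 + c 2 = 3 / 2
  pairs : c 0 * c 1 + c 0 * c 2 + c 1 * c 2 = 0
  prod : c 0 * c 1 * c 2 = (v - 1) / 2

namespace IsFibre

variable {v : Ω} {c : Fin 3 → Ω}

theorem swap (h : IsFibre v c) : IsFibre v (c ∘ Equiv.swap 0 1) := by
  have h2 : Equiv.swap (0 : Fin 3) 1 2 = 2 := by decide
  refine ⟨?_, ?_, ?_⟩ <;> simp only [Function.comp, Equiv.swap_apply_left, Equiv.swap_apply_right, h2]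
  · rw [← h.sum]; ring
  · rw [← h.pairs]; ring
  · rw [← h.prod]; ring

variable [CharZero Ω]

theorem sq_vandermonde (h : IsFibre v c) :
    vandermondeThree c ^ 2 = 27 / 4 * (v * (1 - v)) := by
  have h0 : c 2 = 3 / 2 - c 0 - c 1 := by linear_combination h.sum
  have h1 := h.pairs
  have h2 : v = 2 * (c 0 * c 1 * c 2) + 1 := by linear_combination (-2) * h.prod
  rw [h0] at h1 h2
  rw [vandermondeThree_eq, h2, h0]
  generalize c 0 = x at *
  generalize c 1 = y at *
  -- The coefficient collects the terms of the discriminant of a cubic that are divisible by the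
  -- second elementary symmetric function, which vanishes here.
  linear_combination (9 / 4 * (x * y + x * (3 / 2 - x - y) + y * (3 / 2 - x - y)) -
    4 * (x * y + x * (3 / 2 - x - y) + y * (3 / 2 - x - y)) ^ 2 +
    27 * (x * y * (3 / 2 - x - y))) * h1

theorem cubicMap_eq_iff (h : IsFibre v c) {x : Ω} : cubicMap x = v ↔ ∃ i, x = c i := by
  have e : cubicMap x - v = 2 * ((x - c 0) * (x - c 1) * (x - c 2)) := by
    rw [cubicMap_eq]
    linear_combination (-2 * x ^ 2) * h.sum.symm + 2 * x * h.pairs.symm + 2 * h.prod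
  rw [← sub_eq_zero, e]
  constructor
  · intro h
    rcases mul_eq_zero.1 ((mul_eq_zero.1 h).resolve_left two_ne_zero) with h | h
    · rcases mul_eq_zero.1 h with h | h
      exacts [⟨0, sub_eq_zero.1 h⟩, ⟨1, sub_eq_zero.1 h⟩]
    · exact ⟨2, sub_eq_zero.1 h⟩
  · rintro ⟨i, rfl⟩
    fin_cases i <;> simp

theorem injective (h : IsFibre v c) (hv : v * (1 - v) ≠ 0) : Function.Injective c := by
  have h1 : vandermondeThree c ≠ 0 := by
    intro h0
    have := h.sq_vandermonde
    rw [h0, zero_pow two_ne_zero] at this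
    exact mul_ne_zero (by norm_num) hv this.symm
  exact Matrix.det_vandermonde_ne_zero_iff.1 h1

/-- Swapping two roots changes the sign of the Vandermonde product, so either square root of the
discriminant can be prescribed. -/
theorem exists_isFibre [IsAlgClosed Ω] (v d : Ω) (hd : d ^ 2 = 27 / 4 * (v * (1 - v))) :
    ∃ c, IsFibre v c ∧ vandermondeThree c = d := by
  obtain ⟨x, hx⟩ : ∃ x : Ω, 2 * x ^ 3 - 3 * x ^ 2 + (1 - v) = 0 := by
    obtain ⟨x, hx⟩ := IsAlgClosed.exists_root (C 2 * X ^ 3 + C (-3) * X ^ 2 + C 0 * X + C (1 - v))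
      (by rw [degree_cubic (two_ne_zero' Ω)]; decide)
    refine ⟨x, ?_⟩
    simp [IsRoot.def] at hx
    linear_combination hx
  obtain ⟨y, hy⟩ : ∃ y : Ω, y ^ 2 - (3 / 2 - x) * y + (x ^ 2 - 3 / 2 * x) = 0 := by
    obtain ⟨y, hy⟩ := IsAlgClosed.exists_root (C 1 * X ^ 2 + C (-(3 / 2 - x)) * X +
      C (x ^ 2 - 3 / 2 * x)) (by rw [degree_quadratic (one_ne_zero' Ω)]; decide)
    refine ⟨y, ?_⟩
    simp [IsRoot.def] at hy
    linear_combination hy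
  set c : Fin 3 → Ω := ![x, y, 3 / 2 - x - y] with hc
  have h0 : c 0 = x := rfl
  have h1 : c 1 = y := rfl
  have h2 : c 2 = 3 / 2 - x - y := rfl
  have h : IsFibre v c := by
    refine ⟨?_, ?_, ?_⟩ <;> rw [h0, h1, h2]
    · ring
    · linear_combination -hy
    · linear_combination (-x) * hy + hx / 2
  have hsq : (vandermondeThree c - d) * (vandermondeThree c + d) = 0 := by
    linear_combination h.sq_vandermonde - hd
  rcases mul_eq_zero.1 hsq with h3 | h3
  · exact ⟨c, h, sub_eq_zero.1 h3⟩
  · refine ⟨_, h.swap, ?_⟩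
    rw [vandermondeThree_comp, Equiv.Perm.sign_swap (by decide)]
    push_cast
    linear_combination -h3

/-- The cubic maps {0, 1} to itself, so no preimage of a value outside this set lies in it. -/
theorem ne_zero (h : IsFibre v c) (hv : v * (1 - v) ≠ 0) (i : Fin 3) : c i * (1 - c i) ≠ 0 := by
  have h1 : cubicMap (c i) = v := h.cubicMap_eq_iff.2 ⟨i, rfl⟩
  intro h2
  apply hv
  rw [← h1, cubicMap_eq]
  linear_combination (-(2 * c i ^ 2 - c i - 1) * c i * (3 - 2 * c i)) * h2

end IsFibre

/-- The triple of the children of the vertex `w` in a labelled tree. -/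
def children (t : ∀ k, (Fin k → Fin 3) → Ω) {k : ℕ} (w : Fin k → Fin 3) : Fin 3 → Ω :=
  fun i => t (k + 1) (Fin.snoc w i)

/-- A labelling of the vertices of the ternary tree by the iterated preimages of its root under the
cubic map, with the orderings of the fibres chosen coherently. -/
structure IsLabeling (t : ∀ k, (Fin k → Fin 3) → Ω) : Prop where
  fibre : ∀ {k} (w : Fin k → Fin 3), IsFibre (t k w) (children t w)
  nonsing : ∀ {k} (w : Fin k → Fin 3), t k w * (1 - t k w) ≠ 0
  coherent : ∀ {k} (w : Fin k → Fin 3), vandermondeThree (children t w) *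
    ∏ i, vandermondeThree (children t (Fin.snoc w i : Fin (k + 1) → Fin 3)) =
      (27 / 4) ^ 2 * (t k w * (1 - t k w)) / 2

/-- The labelling of the subtree below the vertex `i` of level one. -/
def subLabeling (t : ∀ k, (Fin k → Fin 3) → Ω) (i : Fin 3) : ∀ k, (Fin k → Fin 3) → Ω :=
  fun k w => t (k + 1) (Fin.cons i w)

theorem children_subLabeling {Ω : Type*} (t : ∀ k, (Fin k → Fin 3) → Ω) (i : Fin 3) {k : ℕ}
    (w : Fin k → Fin 3) :
    children (subLabeling t i) w = children t (Fin.cons i w : Fin (k + 1) → Fin 3) := by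
  funext j
  rw [children, subLabeling, children, Fin.cons_snoc_eq_snoc_cons]

theorem subLabeling_root {Ω : Type*} (t : ∀ k, (Fin k → Fin 3) → Ω) (i : Fin 3) :
    subLabeling t i 0 Fin.elim0 = children t Fin.elim0 i := by
  rw [children, subLabeling]
  congr 1
  funext j
  rw [Subsingleton.elim (α := Fin 1) j 0]
  rfl

namespace IsLabeling

variable {t : ∀ k, (Fin k → Fin 3) → Ω}

theorem sub (h : IsLabeling t) (i : Fin 3) : IsLabeling (subLabeling t i) where
  fibre w := by
    rw [children_subLabeling]
    exact h.fibre _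
  nonsing w := h.nonsing _
  coherent w := by
    rw [children_subLabeling, subLabeling, ← h.coherent]
    simp only [children_subLabeling, Fin.cons_snoc_eq_snoc_cons]

variable [CharZero Ω]

theorem children_injective (h : IsLabeling t) {k : ℕ} (w : Fin k → Fin 3) :
    Function.Injective (children t w) :=
  (h.fibre w).injective (h.nonsing w)

theorem cubicMap_apply (h : IsLabeling t) {k : ℕ} (w : Fin (k + 1) → Fin 3) :
    cubicMap (t (k + 1) w) = t k (Fin.init w) :=
  (h.fibre (Fin.init w)).cubicMap_eq_iff.2 ⟨w (Fin.last k), by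
    rw [children, Fin.snoc_init_self]⟩

theorem injective (h : IsLabeling t) : ∀ k, Function.Injective (t k)
  | 0 => fun _ _ _ => Subsingleton.elim _ _
  | k + 1 => by
    intro w w' e
    have h1 : Fin.init w = Fin.init w' := by
      apply h.injective k
      rw [← h.cubicMap_apply, ← h.cubicMap_apply, e]
    rw [← Fin.snoc_init_self w, ← Fin.snoc_init_self w', ← h1] at e ⊢
    rw [h.children_injective _ e]

theorem iterate_eq_iff (h : IsLabeling t) {k : ℕ} {x : Ω} :
    cubicMap^[k] x = t 0 Fin.elim0 ↔ ∃ w, x = t k w := by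
  induction k generalizing x with
  | zero =>
    constructor
    · exact fun h => ⟨_, h⟩
    · rintro ⟨w, rfl⟩
      exact congrArg (t 0) (Subsingleton.elim _ _)
  | succ k ih =>
    rw [Function.iterate_succ_apply, ih]
    constructor
    · rintro ⟨w, hw⟩
      obtain ⟨i, hi⟩ := (h.fibre w).cubicMap_eq_iff.1 hw
      exact ⟨_, hi⟩
    · rintro ⟨w, rfl⟩
      exact ⟨_, h.cubicMap_apply w⟩

end IsLabeling

/-- The tree is built downwards with each vertex carrying its value together with a prescribed
square root of the discriminant of its fibre. For two of the three children the root is arbitrary;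
for the third it is dictated by coherence. -/
theorem exists_isLabeling [CharZero Ω] [IsAlgClosed Ω] (a : Ω) (ha : a * (1 - a) ≠ 0) :
    ∃ t : ∀ k, (Fin k → Fin 3) → Ω, IsLabeling t ∧ t 0 Fin.elim0 = a := by
  let S := {p : Ω × Ω // p.1 * (1 - p.1) ≠ 0 ∧ p.2 ^ 2 = 27 / 4 * (p.1 * (1 - p.1))}
  have hsqrt : ∀ v : Ω, ∃ d, d ^ 2 = 27 / 4 * (v * (1 - v)) := fun v =>
    IsAlgClosed.exists_pow_nat_eq _ (by norm_num)
  have hstep : ∀ p : S, ∃ q : Fin 3 → S, IsFibre p.1.1 (fun i => (q i).1.1) ∧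
      vandermondeThree (fun i => (q i).1.1) = p.1.2 ∧
      p.1.2 * ∏ i, (q i).1.2 = (27 / 4) ^ 2 * (p.1.1 * (1 - p.1.1)) / 2 := by
    rintro ⟨⟨v, d⟩, hv, hd⟩
    simp only at hv hd
    obtain ⟨c, hc, hcd⟩ := IsFibre.exists_isFibre v d hd
    obtain ⟨d0, h0⟩ := hsqrt (c 0)
    obtain ⟨d1, h1⟩ := hsqrt (c 1)
    have hn := hc.ne_zero hv
    have hne : ∀ {x e : Ω}, x * (1 - x) ≠ 0 → e ^ 2 = 27 / 4 * (x * (1 - x)) → e ≠ 0 := by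
      rintro x e hx he rfl
      rw [zero_pow two_ne_zero] at he
      exact mul_ne_zero (by norm_num) hx he.symm
    have hd' := hne hv hd
    have h0' := hne (hn 0) h0
    have h1' := hne (hn 1) h1
    -- Solves the coherence relation for the third root; it squares to the right discriminant
    -- because the product of the `c i * (1 - c i)` is `v * (1 - v) / 4`.
    set d2 : Ω := (27 / 4) ^ 2 * (v * (1 - v)) / 2 / (d * d0 * d1) with hd2
    have h2 : d2 ^ 2 = 27 / 4 * (c 2 * (1 - c 2)) := by
      have hprod : (c 0 * (1 - c 0)) * (c 1 * (1 - c 1)) * (c 2 * (1 - c 2)) =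
          v * (1 - v) / 4 := by
        linear_combination hc.prod * ((1 - c 0) * (1 - c 1) * (1 - c 2)) +
          (v - 1) / 2 * (hc.pairs - hc.sum - hc.prod)
      rw [hd2, div_pow, div_eq_iff (pow_ne_zero 2 (mul_ne_zero (mul_ne_zero hd' h0') h1')),
        mul_pow, mul_pow, hd, h0, h1]
      linear_combination (-(27 / 4) ^ 4 * (v * (1 - v))) * hprod
    refine ⟨![⟨(c 0, d0), hn 0, h0⟩, ⟨(c 1, d1), hn 1, h1⟩, ⟨(c 2, d2), hn 2, h2⟩], ?_, ?_, ?_⟩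
    · exact ⟨hc.sum, hc.pairs, hc.prod⟩
    · refine Eq.trans ?_ hcd
      rw [vandermondeThree_eq, vandermondeThree_eq]
      rfl
    · rw [Fin.prod_univ_three]
      change d * (d0 * d1 * d2) = _
      rw [hd2]
      field_simp
  choose q hq1 hq2 hq3 using hstep
  obtain ⟨d, hd⟩ := hsqrt a
  let T : ∀ k, (Fin k → Fin 3) → S := fun k =>
    Nat.rec (motive := fun k => (Fin k → Fin 3) → S) (fun _ => ⟨(a, d), ha, hd⟩)
      (fun k Tk w => q (Tk (Fin.init w)) (w (Fin.last k))) k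
  have hT : ∀ k (w : Fin k → Fin 3) i, T (k + 1) (Fin.snoc w i) = q (T k w) i := by
    intro k w i
    change q (T k (Fin.init (Fin.snoc w i : Fin (k + 1) → Fin 3)))
      ((Fin.snoc w i : Fin (k + 1) → Fin 3) (Fin.last k)) = _
    rw [Fin.init_snoc, Fin.snoc_last]
  have hch : ∀ {k} (w : Fin k → Fin 3),
      children (fun k w => (T k w).1.1) w = fun i => (q (T k w) i).1.1 := by
    intro k w
    funext i
    rw [children, hT]
  refine ⟨fun k w => (T k w).1.1, ⟨fun w => ?_, fun w => (T _ w).2.1, fun w => ?_⟩, rfl⟩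
  · rw [hch]
    exact hq1 _
  · rw [hch, hq2, ← hq3]
    congr 1
    refine Finset.prod_congr rfl fun i _ => ?_
    rw [hch, hq2, hT]

end Labelings

/-! ### The Galois action on labelings lands in `E_n`. -/

section Induced

variable {K Ω : Type*} [Field K] [Field Ω] [Algebra K Ω]

open TreeAut

/-- The field automorphism `g` induces the tree automorphism `σ` between two labelled trees. -/
def Induces (g : Ω ≃ₐ[K] Ω) (t t' : ∀ k, (Fin k → Fin 3) → Ω) {n : ℕ} (σ : TreeAut 3 n) : Prop :=
  ∀ (k : ℕ) (hk : k ≤ n) (w : Fin k → Fin 3), g (t k w) = t' k (lev σ k hk w)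

namespace Induces

variable {g h : Ω ≃ₐ[K] Ω} {t t' t'' : ∀ k, (Fin k → Fin 3) → Ω} {n : ℕ}

theorem mul {σ τ : TreeAut 3 n} (hg : Induces g t' t'' σ) (hh : Induces h t t' τ) :
    Induces (g * h) t t'' (σ * τ) := by
  intro k hk w
  rw [AlgEquiv.mul_apply, hh k hk, hg k hk]
  rfl

theorem one : Induces (1 : Ω ≃ₐ[K] Ω) t t (1 : TreeAut 3 n) := fun _ _ _ => rfl

theorem inv {σ : TreeAut 3 n} (hg : Induces g t t' σ) : Induces g⁻¹ t' t σ⁻¹ := by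
  intro k hk w
  have h := hg k hk (lev σ⁻¹ k hk w)
  rw [← Equiv.Perm.mul_apply, ← lev_mul, mul_inv_cancel] at h
  change _ = t' k w at h
  rw [← h, ← AlgEquiv.mul_apply, inv_mul_cancel, AlgEquiv.one_apply]

theorem mk_iff {a : Fin 3 → TreeAut 3 n} {b : Equiv.Perm (Fin 3)} :
    Induces g t t' (mk a b) ↔ g (t 0 Fin.elim0) = t' 0 Fin.elim0 ∧
      ∀ i, Induces g (subLabeling t i) (subLabeling t' (b i)) (a i) := by
  constructor
  · intro h
    refine ⟨(h 0 (Nat.zero_le _) _).trans (congrArg (t' 0) (Subsingleton.elim _ _)),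
      fun i k hk w => ?_⟩
    rw [subLabeling, h (k + 1) (Nat.succ_le_succ hk), mk_cons]
    rfl
  · rintro ⟨h0, h⟩ k hk w
    cases k with
    | zero =>
      rw [Subsingleton.elim w Fin.elim0, h0]
      exact congrArg (t' 0) (Subsingleton.elim _ _)
    | succ k =>
      obtain ⟨i, w, rfl⟩ : ∃ i w', w = (Fin.cons i w' : Fin (k + 1) → Fin 3) :=
        ⟨w 0, Fin.tail w, (Fin.cons_self_tail w).symm⟩
      rw [mk_cons _ _ k (Nat.le_of_succ_le_succ hk)]
      exact h i k (Nat.le_of_succ_le_succ hk) w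

theorem root {σ : TreeAut 3 n} (hg : Induces g t t' σ) : g (t 0 Fin.elim0) = t' 0 Fin.elim0 :=
  (hg 0 (Nat.zero_le _) _).trans (congrArg (t' 0) (Subsingleton.elim _ _))

theorem children {σ : TreeAut 3 (n + 1)} (hg : Induces g t t' σ) (i : Fin 3) :
    g (children t Fin.elim0 i) = _root_.children t' Fin.elim0 (top σ i) := by
  rw [← subLabeling_root, ← subLabeling_root, subLabeling, hg 1 (Nat.le_add_left 1 n),
    lev_one_cons]
  rfl

theorem vandermonde {σ : TreeAut 3 (n + 1)} (hg : Induces g t t' σ) :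
    g (vandermondeThree (_root_.children t Fin.elim0)) =
      ((Equiv.Perm.sign (top σ) : ℤˣ) : ℤ) * vandermondeThree (_root_.children t' Fin.elim0) := by
  rw [map_vandermondeThree, ← vandermondeThree_comp]
  congr 1
  funext i
  exact hg.children i

theorem unique [CharZero Ω] (ht' : IsLabeling t') {σ τ : TreeAut 3 n} (hσ : Induces g t t' σ)
    (hτ : Induces g t t' τ) : σ = τ :=
  ext_lev fun k hk w => ht'.injective k ((hσ k hk w).symm.trans (hτ k hk w))

end Induces

theorem map_cubicMap (g : Ω ≃ₐ[K] Ω) (x : Ω) : g (cubicMap x) = cubicMap (g x) := by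
  simp [cubicMap_eq, map_ofNat g 2, map_ofNat g 3]

theorem exists_children_perm [CharZero Ω] {t t' : ∀ k, (Fin k → Fin 3) → Ω} (ht : IsLabeling t)
    (ht' : IsLabeling t') {g : Ω ≃ₐ[K] Ω} (hg : g (t 0 Fin.elim0) = t' 0 Fin.elim0) :
    ∃ b : Equiv.Perm (Fin 3), ∀ i, g (children t Fin.elim0 i) = children t' Fin.elim0 (b i) := by
  have h : ∀ i, ∃ j, g (children t Fin.elim0 i) = children t' Fin.elim0 j := by
    intro i
    rw [← (ht'.fibre _).cubicMap_eq_iff, ← hg, ← (ht.fibre Fin.elim0).cubicMap_eq_iff.2 ⟨i, rfl⟩]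
    rw [map_cubicMap]
  choose b hb using h
  have hinj : Function.Injective b := by
    intro i j hij
    have h1 := (hb i).trans ((congrArg _ hij).trans (hb j).symm)
    exact ht.children_injective _ (g.injective h1)
  exact ⟨Equiv.ofBijective b (Finite.injective_iff_bijective.1 hinj), hb⟩

/-- Two labelings are needed because `g` carries the subtree at `i` to the one at `b i`. Applying
`g` to the coherence relation multiplies its left side by `sign b` times the signs of the sections,
while the right side goes to the nonzero right side for `t'`; so the total sign is 1. -/
theorem exists_mem_EGroup_induces [CharZero Ω] (g : Ω ≃ₐ[K] Ω) : ∀ (n : ℕ)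
    {t t' : ∀ k, (Fin k → Fin 3) → Ω}, IsLabeling t → IsLabeling t' →
    g (t 0 Fin.elim0) = t' 0 Fin.elim0 → ∃ σ ∈ EGroup 3 2 n, Induces g t t' σ
  | 0, t, t', _, _, hg => by
    refine ⟨1, one_mem _, fun k hk w => ?_⟩
    obtain rfl : k = 0 := Nat.le_zero.mp hk
    rw [Subsingleton.elim w Fin.elim0, hg]
    exact congrArg (t' 0) (Subsingleton.elim _ _)
  | n + 1, t, t', ht, ht', hg => by
    obtain ⟨b, hb⟩ := exists_children_perm ht ht' hg
    have h : ∀ i, ∃ σ ∈ EGroup 3 2 n, Induces g (subLabeling t i) (subLabeling t' (b i)) σ :=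
      fun i => exists_mem_EGroup_induces g n (ht.sub i) (ht'.sub (b i))
        (by rw [subLabeling_root, subLabeling_root, hb])
    choose a ha hind using h
    refine ⟨mk a b, ?_, Induces.mk_iff.2 ⟨hg, hind⟩⟩
    cases n with
    | zero => trivial
    | succ n =>
      refine mk_mem_EGroup.2 ⟨ha, ?_⟩
      have h1 := congrArg g (ht.coherent Fin.elim0)
      have h2 := (Induces.mk_iff.2 ⟨hg, hind⟩ : Induces g t t' (mk a b)).vandermonde
      have h3 := fun i => (hind i).vandermonde
      have hsub : ∀ (t : ∀ k, (Fin k → Fin 3) → Ω) (i : Fin 3),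
          children t (Fin.snoc Fin.elim0 i : Fin 1 → Fin 3) =
            children (subLabeling t i) Fin.elim0 := by
        intro t i
        rw [children_subLabeling]
        congr 1
        funext j
        rw [Subsingleton.elim (α := Fin 1) j 0]
        rfl
      have h4 := ht'.coherent Fin.elim0
      simp only [hsub] at h1 h4
      rw [map_mul, map_prod, h2, top_mk] at h1
      simp only [h3, Finset.prod_mul_distrib] at h1
      rw [Equiv.prod_comp b (fun i => vandermondeThree (children (subLabeling t' i) Fin.elim0))] at h1
      have hR : g ((27 / 4) ^ 2 * (t 0 Fin.elim0 * (1 - t 0 Fin.elim0)) / 2) =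
          (27 / 4) ^ 2 * (t' 0 Fin.elim0 * (1 - t' 0 Fin.elim0)) / 2 := by
        simp [← hg, map_ofNat g 2, map_ofNat g 4, map_ofNat g 27]
      have hR0 : (27 / 4) ^ 2 * (t' 0 Fin.elim0 * (1 - t' 0 Fin.elim0)) / 2 ≠ 0 :=
        div_ne_zero (mul_ne_zero (by norm_num) (ht'.nonsing _)) two_ne_zero
      rw [hR] at h1
      rw [← Units.val_inj, ← Int.cast_inj (α := Ω), Units.val_mul, Units.coe_prod, Int.cast_mul,
        Int.cast_prod, Units.val_one, Int.cast_one]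
      refine mul_right_cancel₀ hR0 ?_
      refine (Eq.trans ?_ h1).trans (one_mul _).symm
      rw [← h4]
      ring

end Induced

/-! ### Propagation of ramification at 2 along the preimage tree. -/

section Ramification

variable {K Ω Γ₀ : Type*} [Field K] [Field Ω] [Algebra K Ω] [LinearOrderedCommGroupWithZero Γ₀]

theorem Valuation.sum_ne_zero_of_pairwise_ne (w : Valuation Ω Γ₀) {ι : Type*} {s : Finset ι}
    {f : ι → Ω} (hf : ∀ i ∈ s, ∀ j ∈ s, i ≠ j → f i ≠ 0 → f j ≠ 0 → w (f i) ≠ w (f j))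
    (hne : ∃ i ∈ s, f i ≠ 0) : ∑ i ∈ s, f i ≠ 0 := by
  classical
  obtain ⟨i₀, hi₀, hfi₀⟩ := hne
  obtain ⟨m, hm, hmax⟩ := s.exists_max_image (fun i => w (f i)) ⟨i₀, hi₀⟩
  have hwm : w (f m) ≠ 0 := by
    intro h
    have := hmax i₀ hi₀
    rw [h, le_zero_iff, map_eq_zero] at this
    exact hfi₀ this
  have hfm : f m ≠ 0 := (map_ne_zero w).1 hwm
  have hrest : w (∑ i ∈ s.erase m, f i) < w (f m) := by
    refine w.map_sum_lt hwm fun j hj => ?_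
    obtain ⟨hjm, hjs⟩ := Finset.mem_erase.1 hj
    by_cases hfj : f j = 0
    · rw [hfj, map_zero]
      exact zero_lt_iff.2 hwm
    · exact lt_of_le_of_ne (hmax j hjs) (hf j hjs m hm hjm hfj hfm)
  intro h0
  rw [← Finset.add_sum_erase s f hm, add_eq_zero_iff_eq_neg] at h0
  rw [h0, Valuation.map_neg] at hrest
  exact lt_irrefl _ hrest

/-- An element fixed by the stabilizer of a point of an orbit of three elements is a root of a monic
cubic with invariant coefficients. -/
theorem exists_monic_of_mem_fixedField_stabilizer (H : Subgroup (Ω ≃ₐ[K] Ω)) {c : Fin 3 → Ω}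
    (hperm : ∀ h ∈ H, ∃ b : Equiv.Perm (Fin 3), ∀ i, h (c i) = c (b i))
    (i₀ : Fin 3) (htrans : ∀ i, ∃ h ∈ H, h (c i₀) = c i) {x : Ω}
    (hx : x ∈ IntermediateField.fixedField (H ⊓ MulAction.stabilizer (Ω ≃ₐ[K] Ω) (c i₀))) :
    ∃ p : Polynomial Ω, p.natDegree = 3 ∧ p.Monic ∧ p.eval x = 0 ∧
      ∀ j, p.coeff j ∈ IntermediateField.fixedField H := by
  rw [IntermediateField.mem_fixedField_iff] at hx
  choose h hH hh using htrans
  -- Since `x` is fixed by the stabilizer, `h i x` depends only on `c i`, so `H` permutes these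
  -- three conjugates.
  refine ⟨∏ i, (X - C (h i x)), ?_, ?_, ?_, fun j => ?_⟩
  · rw [natDegree_prod_of_monic _ _ fun i _ => monic_X_sub_C _]
    simp
  · exact monic_prod_of_monic _ _ fun i _ => monic_X_sub_C _
  · rw [eval_prod]
    refine Finset.prod_eq_zero (Finset.mem_univ i₀) ?_
    rw [hx (h i₀) ⟨hH i₀, hh i₀⟩]
    simp
  · rw [IntermediateField.mem_fixedField_iff]
    intro g hg
    obtain ⟨b, hb⟩ := hperm g hg
    have key : ∀ i, g (h i x) = h (b i) x := by
      intro i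
      have h1 : ((h (b i))⁻¹ * g * h i) x = x := by
        refine hx _ ⟨H.mul_mem (H.mul_mem (H.inv_mem (hH _)) hg) (hH i), ?_⟩
        change ((h (b i))⁻¹ * g * h i) (c i₀) = c i₀
        rw [AlgEquiv.mul_apply, AlgEquiv.mul_apply, hh, hb, ← hh (b i), ← AlgEquiv.mul_apply,
          inv_mul_cancel, AlgEquiv.one_apply]
      conv_rhs => rw [← h1, ← AlgEquiv.mul_apply, ← mul_assoc, ← mul_assoc, mul_inv_cancel, one_mul]
      rfl
    have hmap : (∏ i, (X - C (h i x))).map (g : Ω →+* Ω) = ∏ i, (X - C (h i x)) := by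
      rw [Polynomial.map_prod, ← Equiv.prod_comp b (fun i => X - C (h i x))]
      refine Finset.prod_congr rfl fun i _ => ?_
      rw [Polynomial.map_sub, map_X, map_C]
      congr 2
      exact key i
    conv_rhs => rw [← hmap]
    rw [coeff_map]
    rfl

/-- If the value of `x` were a fourth root of that of `z`, the nonzero terms of the cubic at `x`
would have pairwise distinct values and could not sum to zero. -/
theorem Valuation.pow_four_ne_of_root (w : Valuation Ω Γ₀) (F : IntermediateField K Ω) {x z : Ω}
    (hzF : z ∈ F) (hz : ∀ y ∈ F, w y ^ 2 ≠ w z) {p : Polynomial Ω} (hdeg : p.natDegree = 3) (hmon : p.Monic)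
    (hroot : p.eval x = 0) (hcoeff : ∀ j, p.coeff j ∈ F) : w x ^ 4 ≠ w z := by
  intro h4
  have hwz : w z ≠ 0 := by
    intro h
    exact hz 0 F.zero_mem (by rw [h, map_zero, zero_pow two_ne_zero])
  have hwx : w x ≠ 0 := by
    intro h
    rw [h, zero_pow (by norm_num)] at h4
    exact hwz h4.symm
  have hx : x ≠ 0 := (map_ne_zero w).1 hwx
  have key : ∀ i j, i < j → j < 4 → p.coeff i ≠ 0 → p.coeff j ≠ 0 →
      w (p.coeff i * x ^ i) ≠ w (p.coeff j * x ^ j) := by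
    intro i j hij hj hi0 hj0 he
    obtain ⟨d, rfl⟩ := Nat.exists_eq_add_of_lt hij
    have hq : p.coeff i / p.coeff (i + d + 1) ∈ F := F.div_mem (hcoeff _) (hcoeff _)
    have hd : w x ^ (d + 1) = w (p.coeff i / p.coeff (i + d + 1)) := by
      rw [map_div₀, eq_div_iff ((map_ne_zero w).2 hj0)]
      refine mul_left_cancel₀ (pow_ne_zero i hwx) ?_
      rw [map_mul, map_mul, map_pow, map_pow] at he
      rw [mul_comm (w x ^ i) (w (p.coeff i)), he, ← mul_assoc, ← pow_add,
        mul_comm, add_assoc]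
    -- With `w q = w x ^ (d + 1)` and `w x ^ 4 = w z`, the elements `q ^ 2`, `q` and `q ^ 2 / z`
    -- respectively have value `w x ^ 2`, whose square is `w z`.
    have : d = 0 ∨ d = 1 ∨ d = 2 := by omega
    rcases this with rfl | rfl | rfl
    · refine hz _ (pow_mem hq 2) ?_
      rw [w.map_pow, ← hd, ← h4, ← pow_mul, ← pow_mul]
    · refine hz _ hq ?_
      rw [← hd, ← h4, ← pow_mul]
    · refine hz _ (F.div_mem (pow_mem hq 2) hzF) ?_
      rw [map_div₀, w.map_pow, ← hd, div_pow, div_eq_iff (pow_ne_zero 2 hwz), ← h4, ← pow_mul,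
        ← pow_mul, ← pow_mul, ← pow_add]
  refine w.sum_ne_zero_of_pairwise_ne (s := Finset.range 4) (f := fun i => p.coeff i * x ^ i) ?_
    ⟨3, by simp, ?_⟩ ?_
  · intro i hi j hj hij hi0 hj0
    rw [Finset.mem_range] at hi hj
    rcases lt_or_gt_of_ne hij with h | h
    · exact key i j h hj (left_ne_zero_of_mul hi0) (left_ne_zero_of_mul hj0)
    · exact (key j i h hi (left_ne_zero_of_mul hj0) (left_ne_zero_of_mul hi0)).symm
  · rw [← hdeg, hmon.coeff_natDegree, one_mul]
    exact pow_ne_zero _ hx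
  · rw [← hroot, eval_eq_sum_range, hdeg]

/-- The value of `a` or `1 - a` at `w` is less than one and not a square in the value group of the
fixed field of `H`. -/
structure IsRamifiedPoint (w : Valuation Ω Γ₀) (H : Subgroup (Ω ≃ₐ[K] Ω)) (a z : Ω) : Prop where
  two_lt : w 2 < 1
  eq : z = a ∨ z = 1 - a
  lt : w z < 1
  ne_sq : ∀ x ∈ IntermediateField.fixedField H, w x ^ 2 ≠ w z

namespace IsRamifiedPoint

variable {w : Valuation Ω Γ₀} {H : Subgroup (Ω ≃ₐ[K] Ω)} {a z : Ω}

theorem map_one_sub (h : IsRamifiedPoint w H a z) : w (1 - z) = 1 := by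
  rw [w.map_sub_eq_of_lt_left (by rw [map_one]; exact h.lt), map_one]

theorem map_three (h : w 2 < 1) : w 3 = 1 := by
  rw [show (3 : Ω) = 1 + 2 by norm_num, w.map_add_eq_of_lt_left (by rwa [map_one]), map_one]

theorem mul_one_sub (h : IsRamifiedPoint w H a z) : a * (1 - a) = z * (1 - z) := by
  rcases h.eq with rfl | rfl
  · rfl
  · ring

theorem ne_zero (h : IsRamifiedPoint w H a z) : a * (1 - a) ≠ 0 := by
  rw [h.mul_one_sub]
  refine mul_ne_zero ?_ ?_
  · rintro rfl
    exact h.ne_sq 0 (zero_mem _) (by rw [map_zero, zero_pow two_ne_zero])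
  · intro h0
    have := h.map_one_sub
    rw [h0, map_zero] at this
    exact zero_ne_one this

theorem mem (h : IsRamifiedPoint w H a z) (ha : a ∈ IntermediateField.fixedField H) :
    z ∈ IntermediateField.fixedField H := by
  rcases h.eq with rfl | rfl
  · exact ha
  · exact sub_mem (one_mem _) ha

variable [CharZero Ω]

/-- `(2V)^2 = 27 z(1 - z)` has the value of `z`, because 3 and `1 - z` have value 1. -/
theorem vandermonde_not_mem (h : IsRamifiedPoint w H a z) {c : Fin 3 → Ω} (hc : IsFibre a c) :
    vandermondeThree c ∉ IntermediateField.fixedField H := by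
  intro hV
  have h2 : (2 : Ω) ∈ IntermediateField.fixedField H := ofNat_mem _ 2
  refine h.ne_sq _ (mul_mem h2 hV) ?_
  have e : (2 * vandermondeThree c) ^ 2 = 3 ^ 3 * (z * (1 - z)) := by
    rw [← h.mul_one_sub]
    linear_combination 4 * hc.sq_vandermonde
  rw [← map_pow, e, map_mul, map_mul, map_pow, map_three h.two_lt, h.map_one_sub, one_pow, one_mul,
    mul_one]

/-- `(4VV')^2` has value `w z * w z' = w z' ^ 3`, so `4VV'/z'` would have value squaring to `w z'`.
This later yields an element of the stabilizer of a child that changes the sign of `V·V'`. -/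
theorem vandermonde_mul_not_mem {y z' : Ω} {H' : Subgroup (Ω ≃ₐ[K] Ω)}
    (h : IsRamifiedPoint w H a z) (h' : IsRamifiedPoint w H' y z')
    (hy : y ∈ IntermediateField.fixedField H') (hzz : w z' ^ 2 = w z) {c c' : Fin 3 → Ω}
    (hc : IsFibre a c) (hc' : IsFibre y c') :
    vandermondeThree c * vandermondeThree c' ∉ IntermediateField.fixedField H' := by
  intro hV
  have h4 : (4 : Ω) ∈ IntermediateField.fixedField H' := ofNat_mem _ 4
  have hz' : w z' ≠ 0 := by
    intro h0
    exact h'.ne_sq 0 (zero_mem _) (by rw [h0, map_zero, zero_pow two_ne_zero])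
  refine h'.ne_sq _ (div_mem (mul_mem h4 hV) (h'.mem hy)) ?_
  have e : (4 * (vandermondeThree c * vandermondeThree c')) ^ 2 =
      3 ^ 6 * (z * (1 - z)) * (z' * (1 - z')) := by
    rw [← h.mul_one_sub, ← h'.mul_one_sub]
    have h1 := hc.sq_vandermonde
    have h2 := hc'.sq_vandermonde
    calc (4 * (vandermondeThree c * vandermondeThree c')) ^ 2
        = 16 * vandermondeThree c ^ 2 * vandermondeThree c' ^ 2 := by ring
      _ = _ := by rw [h1, h2]; ring
  rw [map_div₀, div_pow, div_eq_iff (pow_ne_zero 2 hz'), ← map_pow, e, map_mul, map_mul, map_mul,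
    map_mul, map_pow, map_three h.two_lt, h.map_one_sub, h'.map_one_sub, one_pow, one_mul, mul_one,
    mul_one, ← hzz, mul_comm]

/-- The variable `c` or `1 - c` at a preimage `c` of `a` corresponding to the variable `z` at `a`. -/
theorem exists_child_variable (h : IsRamifiedPoint w H a z) {c : Fin 3 → Ω} (hc : IsFibre a c) :
    ∃ i z', (z' = c i ∨ z' = 1 - c i) ∧ w z' < 1 ∧ w z' ^ 2 = w z := by
  -- From `1 - f(c) = c^2(3 - 2c)` and the symmetry `f(1 - c) = 1 - f(c)`, both choices of `z` lead
  -- to the same equation `d^2(3 - 2d) = z`.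
  obtain ⟨d, hd, hsum, hprod, hroot⟩ : ∃ d : Fin 3 → Ω, (∀ i, d i = c i ∨ d i = 1 - c i) ∧
      d 0 + d 1 + d 2 = 3 / 2 ∧ 2 * (d 0 * d 1 * d 2) = - z ∧
      ∀ i, d i ^ 2 * (3 - 2 * d i) = z := by
    have hmap : ∀ i, cubicMap (c i) = a := fun i => hc.cubicMap_eq_iff.2 ⟨i, rfl⟩
    rcases h.eq with rfl | rfl
    · refine ⟨fun i => 1 - c i, fun _ => Or.inr rfl, ?_, ?_, fun i => ?_⟩
      · linear_combination -hc.sum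
      · linear_combination 2 * hc.pairs - 2 * hc.sum - 2 * hc.prod
      · rw [← hmap i, cubicMap_eq]
        ring
    · refine ⟨c, fun _ => Or.inl rfl, hc.sum, ?_, fun i => ?_⟩
      · linear_combination 2 * hc.prod
      · rw [← hmap i, cubicMap_eq]
        ring
  have hw3 := map_three h.two_lt
  obtain ⟨i, hi⟩ : ∃ i, w (d i) < 1 := by
    -- If every root had value at least 1, each `3 - 2d` would have value below 1 and each `2d`
    -- value 1, whereas the product of the three `2d` is `-4z`.
    by_contra! hge
    have h1 : ∀ i, w (2 * d i) = 1 := by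
      intro i
      have hlt : w (3 - 2 * d i) < 1 := by
        by_contra! hge'
        have : (1 : Γ₀) ≤ w (d i ^ 2 * (3 - 2 * d i)) := by
          rw [map_mul, map_pow]
          exact one_le_mul (one_le_pow_of_one_le' (hge i) 2) hge'
        rw [hroot] at this
        exact absurd h.lt this.not_gt
      have : 2 * d i = 3 - (3 - 2 * d i) := by ring
      rw [this, w.map_sub_eq_of_lt_left (by rwa [hw3]), hw3]
    have h2 : w ((2 * d 0) * (2 * d 1) * (2 * d 2)) = 1 := by
      rw [map_mul, map_mul, h1, h1, h1, one_mul, one_mul]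
    have e : (2 * d 0) * (2 * d 1) * (2 * d 2) = -(2 ^ 2 * z) := by
      linear_combination 4 * hprod
    rw [e, Valuation.map_neg, map_mul, map_pow] at h2
    have : w 2 ^ 2 * w z < 1 :=
      mul_lt_one_of_nonneg_of_lt_one_left zero_le (pow_lt_one₀ zero_le h.two_lt two_ne_zero) h.lt.le
    exact this.ne h2
  refine ⟨i, d i, hd i, hi, ?_⟩
  have h3 : w (3 - 2 * d i) = 1 := by
    rw [w.map_sub_eq_of_lt_left, hw3]
    rw [hw3, map_mul]
    exact mul_lt_one_of_nonneg_of_lt_one_left zero_le h.two_lt hi.le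
  rw [← hroot i, map_mul, h3, mul_one, map_pow]

/-- The original valuation singles out some child `i₀`. To reach a given child `i`, the valuation is
transported by an element of `H` taking `c i₀` to `c i`; this does not change the values at `z` and
on the fixed field of `H`. -/
theorem exists_child (h : IsRamifiedPoint w H a z) (ha : a ∈ IntermediateField.fixedField H)
    {c : Fin 3 → Ω} (hc : IsFibre a c) (htrans : ∀ i j, ∃ h ∈ H, h (c i) = c j) (i : Fin 3) :
    ∃ (w' : Valuation Ω Γ₀) (z' : Ω), IsRamifiedPoint w' H a z ∧
      IsRamifiedPoint w' (H ⊓ MulAction.stabilizer (Ω ≃ₐ[K] Ω) (c i)) (c i) z' ∧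
      w' z' ^ 2 = w' z := by
  have hfix := IntermediateField.mem_fixedField_iff H a |>.1 ha
  have hinj := hc.injective h.ne_zero
  have hperm : ∀ g ∈ H, ∃ b : Equiv.Perm (Fin 3), ∀ i, g (c i) = c (b i) := by
    intro g hg
    have h1 : ∀ i, ∃ j, g (c i) = c j := by
      intro i
      rw [← hc.cubicMap_eq_iff, ← map_cubicMap, hc.cubicMap_eq_iff.2 ⟨i, rfl⟩, hfix g hg]
    choose b hb using h1
    refine ⟨Equiv.ofBijective b (Finite.injective_iff_bijective.1 fun i j hij => ?_), hb⟩
    exact hinj (g.injective ((hb i).trans ((congrArg c hij).trans (hb j).symm)))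
  obtain ⟨i₀, z₀, hz₀, hlt, hsq⟩ := h.exists_child_variable hc
  have hne : ∀ x ∈ IntermediateField.fixedField (H ⊓ MulAction.stabilizer (Ω ≃ₐ[K] Ω) (c i₀)),
      w x ^ 2 ≠ w z₀ := by
    intro x hx he
    obtain ⟨p, h1, h2, h3, h4⟩ := exists_monic_of_mem_fixedField_stabilizer H hperm i₀
      (htrans i₀) hx
    refine w.pow_four_ne_of_root _ (h.mem ha) h.ne_sq h1 h2 h3 h4 ?_
    rw [← hsq, ← he, ← pow_mul]
  obtain ⟨g, hg, hgi⟩ := htrans i₀ i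
  have hgz : g⁻¹ z = z := by
    have := IntermediateField.mem_fixedField_iff H z |>.1 (h.mem ha)
    exact this _ (H.inv_mem hg)
  have hgg : ∀ x, g⁻¹ (g x) = x := fun x => by
    rw [← AlgEquiv.mul_apply, inv_mul_cancel, AlgEquiv.one_apply]
  refine ⟨w.comap ((g⁻¹ : Ω ≃ₐ[K] Ω) : Ω →+* Ω), g z₀, ⟨?_, h.eq, ?_, ?_⟩, ⟨?_, ?_, ?_, ?_⟩, ?_⟩
  · change w (g⁻¹ 2) < 1
    rw [map_ofNat g⁻¹ 2]
    exact h.two_lt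
  · change w (g⁻¹ z) < 1
    rw [hgz]
    exact h.lt
  · intro x hx
    change w (g⁻¹ x) ^ 2 ≠ w (g⁻¹ z)
    rw [hgz, IntermediateField.mem_fixedField_iff H x |>.1 hx _ (H.inv_mem hg)]
    exact h.ne_sq x hx
  · change w (g⁻¹ 2) < 1
    rw [map_ofNat g⁻¹ 2]
    exact h.two_lt
  · rcases hz₀ with rfl | rfl
    · exact Or.inl hgi
    · exact Or.inr (by rw [map_sub, map_one, hgi])
  · change w (g⁻¹ (g z₀)) < 1
    rwa [hgg]
  · intro x hx
    change w (g⁻¹ x) ^ 2 ≠ w (g⁻¹ (g z₀))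
    rw [hgg]
    refine hne _ ?_
    rw [IntermediateField.mem_fixedField_iff] at hx ⊢
    rintro k ⟨hk, hkc⟩
    have hkc : k (c i₀) = c i₀ := hkc
    have h1 : (g * k * g⁻¹) x = x := by
      refine hx _ ⟨H.mul_mem (H.mul_mem hg hk) (H.inv_mem hg), ?_⟩
      change (g * k * g⁻¹) (c i) = c i
      rw [← hgi, AlgEquiv.mul_apply, AlgEquiv.mul_apply, hgg, hkc]
    conv_rhs => rw [← h1, AlgEquiv.mul_apply, AlgEquiv.mul_apply, hgg]
  · change w (g⁻¹ (g z₀)) ^ 2 = w (g⁻¹ z)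
    rw [hgg, hgz, hsq]

end IsRamifiedPoint

end Ramification

/-! ### Surjectivity onto `E_n`. -/

section FullImage

open TreeAut

variable {K Ω Γ₀ : Type*} [Field K] [Field Ω] [Algebra K Ω] [LinearOrderedCommGroupWithZero Γ₀]

theorem map_iterate_cubicMap (g : Ω ≃ₐ[K] Ω) (m : ℕ) (x : Ω) :
    g (cubicMap^[m] x) = cubicMap^[m] (g x) :=
  Function.Commute.iterate_right (f := g) (map_cubicMap g) m x

theorem mem_fixedField_stabilizer (H : Subgroup (Ω ≃ₐ[K] Ω)) (y : Ω) :
    y ∈ IntermediateField.fixedField (H ⊓ MulAction.stabilizer (Ω ≃ₐ[K] Ω) y) :=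
  (IntermediateField.mem_fixedField_iff _ _).2 fun _ hf => hf.2

theorem perm_fin_three_mem_of_transitive_of_odd {B : Subgroup (Equiv.Perm (Fin 3))}
    (htrans : ∀ i j, ∃ b ∈ B, b i = j) (hodd : ∃ b ∈ B, Equiv.Perm.sign b = -1)
    (p : Equiv.Perm (Fin 3)) : p ∈ B := by
  obtain ⟨o, ho, hos⟩ := hodd
  have hswap : ∀ l, Equiv.swap (l + 1) (l + 2) ∈ B := by
    have h1 : ∀ o : Equiv.Perm (Fin 3), Equiv.Perm.sign o = -1 → ∃ k, o k = k := by decide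
    have h2 : ∀ (l : Fin 3) (s : Equiv.Perm (Fin 3)), Equiv.Perm.sign s = -1 → s l = l →
      s = Equiv.swap (l + 1) (l + 2) := by decide
    intro l
    obtain ⟨k, hk⟩ := h1 o hos
    obtain ⟨c, hc, hcl⟩ := htrans k l
    rw [← h2 l (c * o * c⁻¹)]
    · exact B.mul_mem (B.mul_mem hc ho) (B.inv_mem hc)
    · rw [map_mul, map_mul, map_inv, hos, mul_comm, inv_mul_cancel_left]
    · have : c⁻¹ l = k := by rw [Equiv.Perm.inv_eq_iff_eq, hcl]
      rw [Equiv.Perm.mul_apply, Equiv.Perm.mul_apply, this, hk, hcl]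
  have h3 : ∀ p : Equiv.Perm (Fin 3), p = 1 ∨ (∃ l : Fin 3, p = Equiv.swap (l + 1) (l + 2)) ∨
      ∃ l m : Fin 3, p = Equiv.swap (l + 1) (l + 2) * Equiv.swap (m + 1) (m + 2) := by decide
  rcases h3 p with rfl | ⟨l, rfl⟩ | ⟨l, m, rfl⟩
  exacts [B.one_mem, hswap l, B.mul_mem (hswap l) (hswap m)]

/-- The tree automorphisms induced by the elements of `H`. -/
def inducedSubgroup (H : Subgroup (Ω ≃ₐ[K] Ω)) (t : ∀ k, (Fin k → Fin 3) → Ω) (n : ℕ) :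
    Subgroup (TreeAut 3 n) where
  carrier := {σ | ∃ h ∈ H, Induces h t t σ}
  one_mem' := ⟨1, H.one_mem, Induces.one⟩
  mul_mem' := by
    rintro σ τ ⟨g, hg, hσ⟩ ⟨h, hh, hτ⟩
    exact ⟨g * h, H.mul_mem hg hh, hσ.mul hτ⟩
  inv_mem' := by
    rintro σ ⟨g, hg, hσ⟩
    exact ⟨g⁻¹, H.inv_mem hg, hσ.inv⟩

variable {H : Subgroup (Ω ≃ₐ[K] Ω)} {t : ∀ k, (Fin k → Fin 3) → Ω}

/-- `H` acts transitively on the iterated preimages of `a`. -/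
def IsTransitiveOnPreimages (H : Subgroup (Ω ≃ₐ[K] Ω)) (a : Ω) : Prop :=
  ∀ (m : ℕ) (u u' : Ω), cubicMap^[m] u = a → cubicMap^[m] u' = a → ∃ h ∈ H, h u = u'

theorem IsTransitiveOnPreimages.stabilizer {a y : Ω} (h : IsTransitiveOnPreimages H a)
    (hy : cubicMap y = a) :
    IsTransitiveOnPreimages (H ⊓ MulAction.stabilizer (Ω ≃ₐ[K] Ω) y) y := by
  intro m u u' hu hu'
  obtain ⟨g, hg, hgu⟩ := h (m + 1) u u'
    (by rw [Function.iterate_succ_apply', hu, hy]) (by rw [Function.iterate_succ_apply', hu', hy])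
  refine ⟨g, ⟨hg, ?_⟩, hgu⟩
  change g y = y
  conv_lhs => rw [← hu, map_iterate_cubicMap, hgu, hu']

variable [CharZero Ω]

theorem inducedSubgroup_le_EGroup (ht : IsLabeling t) (n : ℕ) :
    inducedSubgroup H t n ≤ EGroup 3 2 n := by
  rintro σ ⟨h, -, hσ⟩
  obtain ⟨τ, hτ, hind⟩ := exists_mem_EGroup_induces h n ht ht hσ.root
  rwa [hσ.unique ht hind]

/-- The image on level one is transitive, and it contains an odd permutation because the Vandermonde
product is not fixed by `H`. -/
theorem exists_top_eq_of_isRamifiedPoint {w : Valuation Ω Γ₀} {z : Ω} (ht : IsLabeling t)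
    (ha : t 0 Fin.elim0 ∈ IntermediateField.fixedField H)
    (htrans : ∀ i j, ∃ h ∈ H, h (children t Fin.elim0 i) = children t Fin.elim0 j)
    (hram : IsRamifiedPoint w H (t 0 Fin.elim0) z) (n : ℕ) (b : Equiv.Perm (Fin 3)) :
    ∃ σ ∈ inducedSubgroup H t (n + 1), top σ = b := by
  have hind : ∀ h ∈ H, ∃ σ ∈ inducedSubgroup H t (n + 1), Induces h t t σ := by
    intro h hh
    obtain ⟨σ, -, hσ⟩ := exists_mem_EGroup_induces h (n + 1) ht ht
      ((IntermediateField.mem_fixedField_iff _ _).1 ha h hh)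
    exact ⟨σ, ⟨h, hh, hσ⟩, hσ⟩
  refine perm_fin_three_mem_of_transitive_of_odd (B := (inducedSubgroup H t (n + 1)).map top)
    (fun i j => ?_) ?_ b
  · obtain ⟨h, hh, hij⟩ := htrans i j
    obtain ⟨σ, hσ, hhσ⟩ := hind h hh
    exact ⟨_, ⟨σ, hσ, rfl⟩, ht.children_injective _ ((hhσ.children i).symm.trans hij)⟩
  · have hV := hram.vandermonde_not_mem (ht.fibre Fin.elim0)
    rw [IntermediateField.mem_fixedField_iff] at hV
    push Not at hV
    obtain ⟨h, hh, hne⟩ := hV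
    obtain ⟨σ, hσ, hhσ⟩ := hind h hh
    refine ⟨_, ⟨σ, hσ, rfl⟩, (Int.units_eq_one_or _).resolve_left fun h1 => hne ?_⟩
    rw [hhσ.vandermonde, h1]
    simp

/-- The group, labeling and valuation vary because the induction passes to the stabilizer of a
child, its subtree and a transported valuation. All three inputs of `EGroup_le_of_generation` come
from ramification and transitivity. -/
theorem EGroup_le_inducedSubgroup : ∀ (n : ℕ) {H : Subgroup (Ω ≃ₐ[K] Ω)}
    {t : ∀ k, (Fin k → Fin 3) → Ω} {w : Valuation Ω Γ₀} {z : Ω}, IsLabeling t →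
    t 0 Fin.elim0 ∈ IntermediateField.fixedField H →
    IsTransitiveOnPreimages H (t 0 Fin.elim0) → IsRamifiedPoint w H (t 0 Fin.elim0) z →
    EGroup 3 2 n ≤ inducedSubgroup H t n
  | 0, H, t, w, z, _, _, _, _ => by
    intro σ _
    refine ⟨1, H.one_mem, fun k hk x => ?_⟩
    obtain rfl : k = 0 := Nat.le_zero.mp hk
    exact congrArg (t 0) (Subsingleton.elim _ _)
  | n + 1, H, t, w, z, ht, ha, htr, hram => by
    have hchild : ∀ i, cubicMap (children t Fin.elim0 i) = t 0 Fin.elim0 :=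
      fun i => (ht.fibre Fin.elim0).cubicMap_eq_iff.2 ⟨i, rfl⟩
    have htrans : ∀ i j, ∃ h ∈ H, h (children t Fin.elim0 i) = children t Fin.elim0 j :=
      fun i j => htr 1 _ _ (hchild i) (hchild j)
    have htop := exists_top_eq_of_isRamifiedPoint ht ha htrans hram n
    cases n with
    | zero =>
      intro σ _
      obtain ⟨τ, hτ, h⟩ := htop (top σ)
      rwa [eq_mk_top σ, ← h, ← eq_mk_top τ]
    | succ m =>
      set G := inducedSubgroup H t (m + 2) with hG
      have hGE : G ≤ EGroup 3 2 (m + 2) := inducedSubgroup_le_EGroup ht _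
      have hstab : ∀ i, ∀ h ∈ H ⊓ MulAction.stabilizer (Ω ≃ₐ[K] Ω) (children t Fin.elim0 i),
          ∃ a b, mk a b ∈ G ∧ b i = i ∧ Induces h t t (mk a b) ∧
            Induces h (subLabeling t i) (subLabeling t i) (a i) := by
        rintro i h ⟨hh, hi⟩
        obtain ⟨σ, hσ, hind⟩ := exists_mem_EGroup_induces h (m + 2) ht ht
          ((IntermediateField.mem_fixedField_iff _ _).1 ha h hh)
        obtain ⟨a, b, -, -, rfl⟩ := mem_EGroup_succ_succ.1 hσ
        have hbi : b i = i := by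
          have h1 := hind.children i
          rw [top_mk] at h1
          exact ht.children_injective _ (h1.symm.trans hi)
        refine ⟨a, b, ⟨h, hh, hind⟩, hbi, hind, ?_⟩
        have := (Induces.mk_iff.1 hind).2 i
        rwa [hbi] at this
      refine EGroup_le_of_generation hGE (fun i τ hτ => ?_) (fun b => ?_) ?_
      · obtain ⟨w', z', -, h', -⟩ := hram.exists_child ha (ht.fibre Fin.elim0) htrans i
        have hroot := subLabeling_root t i
        have IH := EGroup_le_inducedSubgroup (m + 1)
          (H := H ⊓ MulAction.stabilizer (Ω ≃ₐ[K] Ω) (children t Fin.elim0 i))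
          (w := w') (z := z') (ht.sub i) (by rw [hroot]; exact mem_fixedField_stabilizer _ _)
          (by rw [hroot]; exact htr.stabilizer (hchild i)) (by rwa [hroot])
        obtain ⟨h, hh, hind⟩ := IH hτ
        obtain ⟨a, b, h1, h2, -, h3⟩ := hstab i h hh
        exact ⟨a, b, h1, h2, h3.unique (ht.sub i) hind⟩
      · obtain ⟨σ, hσ, rfl⟩ := htop b
        obtain ⟨a, b, -, -, rfl⟩ := mem_EGroup_succ_succ.1 (hGE hσ)
        exact ⟨a, by rwa [top_mk]⟩
      · obtain ⟨w', z', h, h', hsq⟩ := hram.exists_child ha (ht.fibre Fin.elim0) htrans 0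
        have hroot := subLabeling_root t 0
        have hfib := (ht.sub 0).fibre Fin.elim0
        rw [hroot] at hfib
        have hV := h.vandermonde_mul_not_mem h' (mem_fixedField_stabilizer _ _) hsq
          (ht.fibre Fin.elim0) hfib
        rw [IntermediateField.mem_fixedField_iff] at hV
        push Not at hV
        obtain ⟨g, hg, hne⟩ := hV
        obtain ⟨a, b, h1, h2, h3, h4⟩ := hstab 0 g hg
        refine ⟨a, b, h1, h2, (Int.units_eq_one_or _).resolve_left fun hs => hne ?_⟩
        rw [map_mul, h3.vandermonde, h4.vandermonde, top_mk, mul_mul_mul_comm, ← Int.cast_mul,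
          ← Units.val_mul, hs]
        simp

end FullImage

/-! ### Eisenstein polynomials at primes above 3. -/

section Eisenstein

/-- The polynomial `2 X ^ 3 - 3 X ^ 2 + 1` over a commutative ring. -/
noncomputable def cubicPoly (R : Type*) [CommRing R] : Polynomial R := 2 * X ^ 3 - 3 * X ^ 2 + 1

/-- The iterates of `cubicPoly`. -/
noncomputable def cubicIter (R : Type*) [CommRing R] (n : ℕ) : Polynomial R :=
  (cubicPoly R).comp^[n] X

theorem iterSub_eq {K : Type*} [Field K] (n : ℕ) (α : K) : iterSub n α = cubicIter K n - C α := rfl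

variable {R S : Type*} [CommRing R] [CommRing S]

theorem cubicPoly_comp (p : Polynomial R) : (cubicPoly R).comp p = 2 * p ^ 3 - 3 * p ^ 2 + 1 := by
  have h2 : (2 : Polynomial R) = C 2 := (map_ofNat C 2).symm
  have h3 : (3 : Polynomial R) = C 3 := (map_ofNat C 3).symm
  simp [cubicPoly, h2, h3]

theorem cubicIter_succ (n : ℕ) :
    cubicIter R (n + 1) = 2 * cubicIter R n ^ 3 - 3 * cubicIter R n ^ 2 + 1 := by
  rw [cubicIter, Function.iterate_succ_apply', cubicPoly_comp]
  rfl

theorem map_cubicIter (φ : R →+* S) (n : ℕ) : (cubicIter R n).map φ = cubicIter S n := by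
  induction n with
  | zero => exact map_X φ
  | succ n ih => simp [cubicIter_succ, ih]

theorem eval_cubicIter_succ (n : ℕ) (c : R) : (cubicIter R (n + 1)).eval c =
    2 * (cubicIter R n).eval c ^ 3 - 3 * (cubicIter R n).eval c ^ 2 + 1 := by
  simp [cubicIter_succ]

theorem aeval_cubicIter {K Ω : Type*} [Field K] [Field Ω] [Algebra K Ω] (n : ℕ) (x : Ω) :
    aeval x (cubicIter K n) = cubicMap^[n] x := by
  induction n with
  | zero => exact aeval_X x
  | succ n ih =>
    rw [Function.iterate_succ_apply', ← ih, cubicMap_eq, cubicIter_succ]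
    simp [map_ofNat (aeval x) 2, map_ofNat (aeval x) 3]

theorem natDegree_cubicIter [NoZeroDivisors R] (h : (2 : R) ≠ 0) (n : ℕ) :
    (cubicIter R n).natDegree = 3 ^ n := by
  have : Nontrivial R := ⟨2, 0, h⟩
  have h3 : (cubicPoly R).natDegree = 3 := by
    rw [cubicPoly]
    compute_degree!
  rw [cubicIter, natDegree_iterate_comp, h3, natDegree_X, mul_one]

/-- The cubic interchanges 0 and 1, so each iterate permutes them. -/
theorem exists_eval_cubicIter_eq (n : ℕ) : ∀ e : R, (e = 0 ∨ e = 1) →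
    ∃ c : R, (c = 0 ∨ c = 1) ∧ (cubicIter R n).eval c = e := by
  induction n with
  | zero => exact fun e he => ⟨e, he, eval_X⟩
  | succ n ih =>
    intro e he
    obtain ⟨c, hc, h⟩ := ih (1 - e) (by rcases he with rfl | rfl <;> simp)
    refine ⟨c, hc, ?_⟩
    rw [eval_cubicIter_succ, h]
    rcases he with rfl | rfl <;> norm_num

/-- In characteristic 3 the cubic is `1 - z^3`, and cubing is additive. -/
theorem exists_cubicIter_comp_eq (h3 : (3 : R) = 0) (c : R) (n : ℕ) :
    ∃ s : R, IsUnit s ∧ (cubicIter R n).comp (X + C c) =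
      C s * X ^ 3 ^ n + C ((cubicIter R n).eval c) := by
  induction n with
  | zero => exact ⟨1, isUnit_one, by simp [cubicIter]⟩
  | succ n ih =>
    obtain ⟨s, hs, h⟩ := ih
    refine ⟨-s ^ 3, (hs.pow 3).neg, ?_⟩
    have h3' : (3 : Polynomial R) = 0 := by
      rw [← map_ofNat C 3, h3, map_zero]
    have e : (cubicIter R (n + 1)).comp (X + C c) = 2 * (cubicIter R n).comp (X + C c) ^ 3 -
        3 * (cubicIter R n).comp (X + C c) ^ 2 + 1 := by
      simp [cubicIter_succ]
    rw [e, h, eval_cubicIter_succ]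
    simp only [map_neg, map_pow, map_add, map_sub, map_mul, map_one, map_ofNat]
    generalize C (eval c (cubicIter R n)) = B
    rw [pow_succ 3 n, pow_mul]
    generalize (X : Polynomial R) ^ 3 ^ n = A
    generalize C s = s
    linear_combination ((s * A) ^ 3 + 2 * (s * A) ^ 2 * B + 2 * (s * A) * B ^ 2 - (s * A) ^ 2 -
      2 * (s * A) * B) * h3'

variable {K : Type*} [Field K]

open WithZero in
theorem exists_isEisensteinAt_cubicIter [CharZero K] (v : Valuation K (WithZero (Multiplicative ℤ)))
    (h3 : v 3 < 1) {α e : K} (he : e = 0 ∨ e = 1) (hα : v (e - α) = exp (-1 : ℤ)) (n : ℕ) :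
    ∃ c : K, (c = 0 ∨ c = 1) ∧ ∃ g : Polynomial v.valuationSubring,
      g.map (algebraMap v.valuationSubring K) = (iterSub n α).comp (X + C c) ∧
      g.natDegree = 3 ^ n ∧
      g.IsEisensteinAt (IsLocalRing.maximalIdeal v.valuationSubring) := by
  set O := v.valuationSubring with hO
  have hlt : v (e - α) < 1 := by
    rw [hα, ← exp_zero, exp_lt_exp]
    norm_num
  obtain ⟨eO, heO, he'⟩ : ∃ eO : O, (eO : K) = e ∧ (eO = 0 ∨ eO = 1) := by
    rcases he with rfl | rfl
    exacts [⟨0, rfl, Or.inl rfl⟩, ⟨1, rfl, Or.inr rfl⟩]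
  let δ : O := ⟨e - α, hlt.le⟩
  have hδ : δ ∈ IsLocalRing.maximalIdeal O := (Valuation.mem_maximalIdeal_iff K v).2 hlt
  obtain ⟨c, hc, hce⟩ := exists_eval_cubicIter_eq n eO he'
  have h2 : (2 : O) ≠ 0 := by
    intro h
    have : ((2 : O) : K) = 0 := by rw [h]; rfl
    exact two_ne_zero this
  -- `eO - δ` is `α` seen in the valuation ring; since the iterate takes the value `eO` at `c`, the
  -- constant term of `g` is `δ`, of valuation 1.
  set g : Polynomial O := (cubicIter O n - C (eO - δ)).comp (X + C c) with hg
  have hdeg : g.natDegree = 3 ^ n := by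
    rw [hg, natDegree_comp, natDegree_sub_C, natDegree_cubicIter h2, natDegree_X_add_C, mul_one]
  have hres : (IsLocalRing.residue O) 3 = 0 := by
    rw [IsLocalRing.residue_eq_zero_iff, Valuation.mem_maximalIdeal_iff]
    exact h3
  obtain ⟨s, hs, hcomp⟩ := exists_cubicIter_comp_eq (R := IsLocalRing.ResidueField O)
    (by rw [← hres, map_ofNat]) (IsLocalRing.residue O c) n
  have hmap : g.map (IsLocalRing.residue O) = C s * X ^ 3 ^ n := by
    have h1 : (cubicIter (IsLocalRing.ResidueField O) n).eval (IsLocalRing.residue O c) =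
        IsLocalRing.residue O eO := by
      rw [← map_cubicIter (IsLocalRing.residue O), eval_map_apply, hce]
    rw [hg, map_comp, Polynomial.map_sub, map_cubicIter, Polynomial.map_add, map_X, map_C, map_C,
      sub_comp, C_comp, hcomp, h1, map_sub, (IsLocalRing.residue_eq_zero_iff δ).2 hδ, sub_zero,
      add_sub_cancel_right]
  have hcoeff : ∀ k, IsLocalRing.residue O (g.coeff k) = if k = 3 ^ n then s else 0 := by
    intro k
    rw [← coeff_map, hmap, coeff_C_mul, coeff_X_pow]
    split_ifs <;> simp
  have h0 : g.coeff 0 = δ := by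
    rw [coeff_zero_eq_eval_zero, hg, eval_comp]
    simp [hce]
  refine ⟨c, ?_, g, ?_, hdeg, ?_, ?_, ?_⟩
  · rcases hc with rfl | rfl
    exacts [Or.inl rfl, Or.inr rfl]
  · rw [hg, map_comp, Polynomial.map_sub, map_cubicIter, Polynomial.map_add, map_X, map_C, map_C,
      iterSub_eq, map_sub]
    congr 3
    change (eO : K) - (e - α) = α
    rw [heO, sub_sub_cancel]
  · rw [leadingCoeff, hdeg, ← IsLocalRing.residue_eq_zero_iff, hcoeff, if_pos rfl]
    exact hs.ne_zero
  · intro k hk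
    rw [← IsLocalRing.residue_eq_zero_iff, hcoeff, if_neg (hdeg ▸ hk.ne)]
  · rw [h0]
    have hsq : ∀ x ∈ IsLocalRing.maximalIdeal O ^ 2, v (x : K) ≤ exp (-2 : ℤ) := by
      have hle : ∀ a ∈ IsLocalRing.maximalIdeal O, v (a : K) ≤ exp (-1 : ℤ) := by
        intro a ha
        have h1 := (Valuation.mem_maximalIdeal_iff K v).1 ha
        by_cases h0 : v (a : K) = 0
        · rw [h0]; exact zero_le
        · rw [← exp_log h0] at h1 ⊢
          rw [← exp_zero, exp_lt_exp] at h1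
          rw [exp_le_exp]
          omega
      intro x hx
      rw [pow_two] at hx
      refine Submodule.mul_induction_on hx (fun a ha b hb => ?_) (fun a b ha hb => ?_)
      · have : (-2 : ℤ) = -1 + -1 := by norm_num
        change v ((a : K) * b) ≤ _
        rw [map_mul, this, exp_add]
        exact mul_le_mul' (hle a ha) (hle b hb)
      · exact v.map_add_le ha hb
    intro hmem
    have := hsq δ hmem
    change v (e - α) ≤ _ at this
    rw [hα, exp_le_exp] at this
    norm_num at this

theorem irreducible_of_comp_X_add_C {p : Polynomial K} {c : K}
    (h : Irreducible (p.comp (X + C c))) : Irreducible p :=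
  (MulEquiv.irreducible_iff (algEquivAevalXAddC c)).1 h

/-- The leading coefficient is a unit but need not be 1, so `g` is rescaled to be monic before
Gauss's lemma is applied. -/
theorem Polynomial.IsEisensteinAt.irreducible_map_of_valuationSubring {O : ValuationSubring K}
    {g : Polynomial O} (hg : g.IsEisensteinAt (IsLocalRing.maximalIdeal O)) (h0 : 0 < g.natDegree) :
    Irreducible (g.map (algebraMap O K)) := by
  have hu : IsUnit g.leadingCoeff := by
    by_contra h
    exact hg.leading ((IsLocalRing.mem_maximalIdeal _).2 h)
  have hprim : g.IsPrimitive := by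
    intro r hr
    exact isUnit_of_dvd_unit ((C_dvd_iff_dvd_coeff r g).1 hr _) hu
  have hirr := hg.irreducible (IsLocalRing.maximalIdeal.isMaximal O).isPrime hprim h0
  obtain ⟨u, hu⟩ := hu
  have hC : IsUnit (C ((u⁻¹ : Oˣ) : O)) := isUnit_C.2 u⁻¹.isUnit
  have hmon : (C ((u⁻¹ : Oˣ) : O) * g).Monic := by
    rw [Monic, leadingCoeff_mul, leadingCoeff_C, ← hu, Units.inv_mul]
  have h1 := (Monic.irreducible_iff_irreducible_map_fraction_map (K := K) hmon).1
    ((irreducible_isUnit_mul hC).2 hirr)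
  rw [Polynomial.map_mul, irreducible_isUnit_mul] at h1
  · exact h1
  · exact hC.map (mapRingHom (algebraMap O K))

end Eisenstein

/-! ### Extension of the valuation and identification of the Galois group. -/

section Main

variable {K Ω : Type*} [Field K] [Field Ω] [Algebra K Ω]

/-- A valuation ring of `Ω` dominating that of `v` is enough. Its value group is not compared with
`Γ`, so only the relations "less than 1" and "equal to 1" are transferred. -/
theorem exists_valuation_extension {Γ : Type*} [LinearOrderedCommGroupWithZero Γ]
    (v : Valuation K Γ) (Ω : Type*) [Field Ω] [Algebra K Ω] : ∃ A : ValuationSubring Ω, ∀ x : K,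
      (v x < 1 → A.valuation (algebraMap K Ω x) < 1) ∧
        (v x = 1 → A.valuation (algebraMap K Ω x) = 1) := by
  obtain ⟨A, hA, hloc⟩ := IsLocalRing.exists_factor_valuationRing
    ((algebraMap K Ω).comp v.valuationSubring.subtype)
  have hle : ∀ x : K, v x ≤ 1 → A.valuation (algebraMap K Ω x) ≤ 1 := fun x hx =>
    (A.valuation_le_one_iff _).2 (hA ⟨x, hx⟩)
  refine ⟨A, fun x => ⟨fun hx => lt_of_le_of_ne (hle x hx.le) fun h1 => ?_, fun hx => ?_⟩⟩
  · have hu : IsUnit (⟨algebraMap K Ω x, hA ⟨x, hx.le⟩⟩ : A) := (A.valuation_eq_one_iff _).2 h1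
    have hu' : IsUnit (⟨x, hx.le⟩ : v.valuationSubring) := hloc.map_nonunit _ hu
    have hm := (Valuation.mem_maximalIdeal_iff K v (a := ⟨x, hx.le⟩)).2 hx
    exact (IsLocalRing.mem_maximalIdeal _).1 hm hu'
  · have hx0 : x ≠ 0 := by
      rintro rfl
      simp at hx
    refine le_antisymm (hle x hx.le) ?_
    have h := hle x⁻¹ (by rw [map_inv₀, hx, inv_one])
    rw [map_inv₀, map_inv₀] at h
    have h0 : A.valuation (algebraMap K Ω x) ≠ 0 := by
      rw [_root_.map_ne_zero, _root_.map_ne_zero]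
      exact hx0
    exact (inv_le_one₀ (zero_lt_iff.2 h0)).1 h

open WithZero in
theorem exists_isRamifiedPoint_top [IsGalois K Ω] (v : Valuation K (WithZero (Multiplicative ℤ)))
    (h2 : v 2 < 1) {α : K} (hα : v α = exp (-1 : ℤ) ∨ v (1 - α) = exp (-1 : ℤ)) :
    ∃ (A : ValuationSubring Ω) (z : Ω),
      IsRamifiedPoint A.valuation (⊤ : Subgroup (Ω ≃ₐ[K] Ω)) (algebraMap K Ω α) z := by
  obtain ⟨A, hA⟩ := exists_valuation_extension v Ω
  obtain ⟨ζ, hζ, hζv⟩ : ∃ ζ : K, (ζ = α ∨ ζ = 1 - α) ∧ v ζ = exp (-1 : ℤ) := by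
    rcases hα with h | h
    exacts [⟨α, Or.inl rfl, h⟩, ⟨1 - α, Or.inr rfl, h⟩]
  have hζlt : v ζ < 1 := by
    rw [hζv, ← exp_zero, exp_lt_exp]
    norm_num
  have hζ0 : ζ ≠ 0 := by
    rintro rfl
    rw [map_zero] at hζv
    exact exp_ne_zero hζv.symm
  refine ⟨A, algebraMap K Ω ζ, ⟨?_, ?_, (hA ζ).1 hζlt, ?_⟩⟩
  · rw [← map_ofNat (algebraMap K Ω) 2]
    exact (hA 2).1 h2
  · rcases hζ with rfl | rfl
    · exact Or.inl rfl
    · exact Or.inr (by rw [map_sub, map_one])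
  · intro x hx he
    rw [IntermediateField.mem_fixedField_iff] at hx
    obtain ⟨k, rfl⟩ := IntermediateField.mem_bot.1
      ((InfiniteGalois.mem_bot_iff_fixed (k := K) x).2 fun f => hx f trivial)
    have hz0 : A.valuation (algebraMap K Ω ζ) ≠ 0 := by
      rw [_root_.map_ne_zero, _root_.map_ne_zero]
      exact hζ0
    have hk0 : k ≠ 0 := by
      rintro rfl
      rw [map_zero, map_zero, zero_pow two_ne_zero] at he
      exact hz0 he.symm
    have hquot : A.valuation (algebraMap K Ω (k ^ 2 / ζ)) = 1 := by
      rw [map_div₀, map_div₀, map_pow, map_pow, he, div_self hz0]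
    have hquot' : A.valuation (algebraMap K Ω (k ^ 2 / ζ)⁻¹) = 1 := by
      rw [map_inv₀, map_inv₀, hquot, inv_one]
    -- The exponent of `v ζ` is odd, so `v (k ^ 2 / ζ)` is not 1; the extension keeps it, or its
    -- inverse, below 1.
    rcases lt_trichotomy (v (k ^ 2 / ζ)) 1 with h | h | h
    · exact ((hA _).1 h).ne hquot
    · have hvk : v k ≠ 0 := (map_ne_zero v).2 hk0
      rw [map_div₀, map_pow, hζv, div_eq_one_iff_eq exp_ne_zero, ← exp_log hvk, ← exp_nsmul,
        exp_inj] at h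
      rw [nsmul_eq_mul] at h
      push_cast at h
      omega
    · refine ((hA (k ^ 2 / ζ)⁻¹).1 ?_).ne hquot'
      rw [map_inv₀]
      exact inv_lt_one_of_one_lt₀ h

theorem isTransitiveOnPreimages_top [Normal K Ω] {α : K} (hirr : ∀ m, Irreducible (iterSub m α)) :
    IsTransitiveOnPreimages (⊤ : Subgroup (Ω ≃ₐ[K] Ω)) (algebraMap K Ω α) := by
  intro m u u' hu hu'
  have hroot : ∀ u : Ω, cubicMap^[m] u = algebraMap K Ω α → aeval u (iterSub m α) = 0 := by
    intro u hu
    rw [iterSub_eq, map_sub, aeval_cubicIter, aeval_C, hu, sub_self]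
  have h := (minpoly.eq_of_irreducible (hirr m) (hroot u' hu')).symm.trans
    (minpoly.eq_of_irreducible (hirr m) (hroot u hu))
  obtain ⟨g, hg⟩ := (Normal.minpoly_eq_iff_mem_orbit Ω).1 h
  exact ⟨g, trivial, hg⟩

theorem nonempty_gal_mulEquiv_EGroup [CharZero K] [IsAlgClosed Ω] [IsGalois K Ω] {α : K}
    (hirr : ∀ m, Irreducible (iterSub m α)) {Γ₀ : Type*} [LinearOrderedCommGroupWithZero Γ₀]
    {w : Valuation Ω Γ₀} {z : Ω}
    (hram : IsRamifiedPoint w (⊤ : Subgroup (Ω ≃ₐ[K] Ω)) (algebraMap K Ω α) z) (n : ℕ) :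
    Nonempty ((iterSub n α).Gal ≃* EGroup 3 2 n) := by
  have : CharZero Ω := charZero_of_injective_algebraMap (algebraMap K Ω).injective
  obtain ⟨t, ht, hta⟩ := exists_isLabeling _ hram.ne_zero
  have hroot : ∀ g : Ω ≃ₐ[K] Ω, g (t 0 Fin.elim0) = t 0 Fin.elim0 := fun g => by
    rw [hta, g.commutes]
  choose σ hσ hind using fun g : Ω ≃ₐ[K] Ω => exists_mem_EGroup_induces g n ht ht (hroot g)
  let ρ : (Ω ≃ₐ[K] Ω) →* EGroup 3 2 n :=
    { toFun := fun g => ⟨σ g, hσ g⟩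
      map_one' := Subtype.ext ((hind 1).unique ht Induces.one)
      map_mul' := fun g h => Subtype.ext ((hind (g * h)).unique ht ((hind g).mul (hind h))) }
  have hρ : Function.Surjective ρ := by
    rintro ⟨τ, hτ⟩
    obtain ⟨g, -, hg⟩ := EGroup_le_inducedSubgroup n ht (H := ⊤) (w := w) (z := z)
      ((IntermediateField.mem_fixedField_iff _ _).2 fun g _ => hroot g)
      (by rw [hta]; exact isTransitiveOnPreimages_top hirr) (by rwa [hta]) hτ
    exact ⟨g, Subtype.ext ((hind g).unique ht hg)⟩
  have hsplits : Fact (((iterSub n α).map (algebraMap K Ω)).Splits) :=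
    ⟨IsAlgClosed.splits _⟩
  have hmem : ∀ x : Ω, x ∈ (iterSub n α).rootSet Ω ↔ ∃ w, x = t n w := by
    intro x
    rw [mem_rootSet_of_ne (hirr n).ne_zero, iterSub_eq, map_sub, aeval_cubicIter, aeval_C,
      sub_eq_zero, ← hta, ht.iterate_eq_iff]
  -- Both kernels consist of the automorphisms fixing level `n` pointwise; lower levels are then
  -- fixed too, being images of level `n` under iterates of the cubic.
  have hker : (Polynomial.Gal.restrict (iterSub n α) Ω).ker = ρ.ker := by
    ext g
    rw [MonoidHom.mem_ker, MonoidHom.mem_ker]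
    have h1 : Polynomial.Gal.restrict (iterSub n α) Ω g = 1 ↔ ∀ w, g (t n w) = t n w := by
      rw [← (Polynomial.Gal.galActionHom_injective (iterSub n α) Ω).eq_iff, map_one]
      constructor
      · intro h w
        have h2 := congrArg Subtype.val (Equiv.congr_fun h ⟨t n w, (hmem _).2 ⟨w, rfl⟩⟩)
        rwa [Polynomial.Gal.galActionHom_restrict] at h2
      · intro h
        refine Equiv.ext fun x => Subtype.ext ?_
        obtain ⟨w, hw⟩ := (hmem x).1 x.2
        rw [Polynomial.Gal.galActionHom_restrict, hw, h w]
        exact hw.symm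
    rw [h1]
    constructor
    · intro h
      have hlev : ∀ (j k : ℕ) (w : Fin k → Fin 3), k + j = n → g (t k w) = t k w := by
        intro j
        induction j with
        | zero =>
          rintro k w rfl
          exact h w
        | succ j ih =>
          intro k w hk
          have h2 := ht.cubicMap_apply (Fin.snoc w 0 : Fin (k + 1) → Fin 3)
          rw [Fin.init_snoc] at h2
          rw [← h2, map_cubicMap, ih (k + 1) _ (by omega)]
      exact Subtype.ext ((hind g).unique ht fun k hk w => hlev (n - k) k w (by omega))
    · intro h w
      have h2 : σ g = 1 := congrArg Subtype.val h
      have h3 := hind g n le_rfl w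
      rwa [h2] at h3
  exact ⟨((QuotientGroup.quotientKerEquivOfSurjective _
    (Polynomial.Gal.restrict_surjective (iterSub n α) Ω)).symm.trans
      (QuotientGroup.quotientMulEquivOfEq hker)).trans
        (QuotientGroup.quotientKerEquivOfSurjective ρ hρ)⟩

end Main

theorem valuation_lt_one_of_liesOver {K : Type*} [Field K] [NumberField K]
    (𝔭 : IsDedekindDomain.HeightOneSpectrum (𝓞 K)) (p : ℕ)
    (h : 𝔭.asIdeal.LiesOver (Ideal.span {(p : ℤ)})) : 𝔭.valuation K (p : K) < 1 := by
  have h1 : (p : 𝓞 K) ∈ 𝔭.asIdeal := by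
    have h2 := (Ideal.mem_of_liesOver 𝔭.asIdeal (Ideal.span {(p : ℤ)}) (p : ℤ)).1
      (Ideal.mem_span_singleton_self _)
    simpa using h2
  have h2 := (𝔭.valuation_lt_one_iff_mem (K := K) (p : 𝓞 K)).2 h1
  simpa using h2

theorem mainTheorem2 {K : Type*} [Field K] [NumberField K] (α : K)
    (𝔭 𝔮 : IsDedekindDomain.HeightOneSpectrum (𝓞 K))
    (h𝔭 : 𝔭.asIdeal.LiesOver (Ideal.span {(2 : ℤ)}))
    (h𝔮 : 𝔮.asIdeal.LiesOver (Ideal.span {(3 : ℤ)}))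
    (hα𝔭 : 𝔭.valuation K α = WithZero.exp (-1 : ℤ) ∨
      𝔭.valuation K (1 - α) = WithZero.exp (-1 : ℤ))
    (hα𝔮 : 𝔮.valuation K α = WithZero.exp (-1 : ℤ) ∨
      𝔮.valuation K (1 - α) = WithZero.exp (-1 : ℤ))
    (n : ℕ) (hn : 1 ≤ n) :
    Irreducible (iterSub n α) ∧
      (∃ c : K, (c = 0 ∨ c = 1) ∧ IsEisensteinAtPrime 𝔮 ((iterSub n α).comp (X + C c))) ∧
      Nonempty ((iterSub n α).Gal ≃* EGroup 3 2 n) := by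
  have h3 : 𝔮.valuation K 3 < 1 := by exact_mod_cast valuation_lt_one_of_liesOver 𝔮 3 h𝔮
  have h2 : 𝔭.valuation K 2 < 1 := by exact_mod_cast valuation_lt_one_of_liesOver 𝔭 2 h𝔭
  obtain ⟨e, he, hα⟩ : ∃ e : K, (e = 0 ∨ e = 1) ∧ 𝔮.valuation K (e - α) = WithZero.exp (-1 : ℤ) := by
    rcases hα𝔮 with h | h
    · exact ⟨0, Or.inl rfl, by rwa [zero_sub, Valuation.map_neg]⟩
    · exact ⟨1, Or.inr rfl, h⟩
  have hirr : ∀ m, Irreducible (iterSub m α) := by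
    intro m
    obtain ⟨c, -, g, hg, hdeg, hE⟩ := exists_isEisensteinAt_cubicIter _ h3 he hα m
    refine irreducible_of_comp_X_add_C (c := c) ?_
    rw [← hg]
    exact hE.irreducible_map_of_valuationSubring (hdeg ▸ pow_pos three_pos m)
  refine ⟨hirr n, ?_, ?_⟩
  · obtain ⟨c, hc, g, hg, -, hE⟩ := exists_isEisensteinAt_cubicIter _ h3 he hα n
    exact ⟨c, hc, g, hg, hE⟩
  · obtain ⟨A, z, hram⟩ := exists_isRamifiedPoint_top (Ω := AlgebraicClosure K) _ h2 hα𝔭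
    exact nonempty_gal_mulEquiv_EGroup hirr hram n
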